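/- Let $\mathcal H$ be a separable complex Hilbert space, and for $k\in\mathbb N$, $k\ge 1$, let $\mathcal B_k(\mathcal H)$ be the Schatten–von Neumann class of bounded operators whose singular numbers have summable $k$-th powers ($\mathcal B_1(\mathcal H)$ is the trace class). For $A\in\mathcal B_k(\mathcal H)$ let $$\det{}_k(I-A)=\det\Big((I-A)\exp\Big(\sum_{j=1}^{k-1}\tfrac1j A^j\Big)\Big)$$ be the modified Fredholm determinant; here the operator on the right differs from $I$ by a trace class operator and $\det$ is the usual Fredholm determinant. Polynomials in $A,B$ are polynomials with complex coefficients in two non-commuting variables. Two such polynomials are said to agree up to cyclic permutations of their terms if their difference is a linear combination of differences $w-w'$ of words $w,w'$ that are cyclic permutations of each other. For $k\ge1$ define polynomials $P_m=P_{k,m}$ by expanding in powers of $t$ $$\sum_{j=1}^{k-1}\frac1j\big((tA+tB-t^2AB)^j-(tA)^j-(tB)^j\big)=\sum_{m=1}^{2k-2}t^mP_m(A,B),$$ so that $P_m$ is homogeneous of degree $m$ for $1\le m\le 2k-2$, and set $$T_k(A,B)=\sum_{m=k}^{2k-2}P_m(A,B).$$ (i) For all $A,B\in\mathcal B_k(\mathcal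 H)$ one has $I-(I-A)(I-B)\in\mathcal B_k(\mathcal H)$, $T_k(A,B)\in\mathcal B_1(\mathcal H)$, and $$\det{}_k((I-A)(I-B))=\det{}_k(I-A)\,\det{}_k(I-B)\,e^{\operatorname{tr}(T_k(A,B))}. \qquad (*)$$ (ii) $T_k$ is unique up to cyclic permutations of its terms: if $\mathcal H$ is infinite-dimensional and $Q$ is a polynomial such that, for all $A,B\in\mathcal B_k(\mathcal H)$, $Q(A,B)\in\mathcal B_1(\mathcal H)$ and $(*)$ holds with $Q$ in place of $T_k$, then $Q$ and $T_k$ agree up to cyclic permutations of their terms. Conversely (in any $\mathcal H$), every polynomial $Q$ all of whose terms have degree at least $k$ and which agrees with $T_k$ up to cyclic permutations of its terms satisfies $Q(A,B)\in\mathcal B_1(\mathcal H)$ and $(*)$ for all $A,B\in\mathcal B_k(\mathcal H)$. (iii) For $k=1,\dots,5$, $T_k$ agrees up to cyclic permutations of its terms with the following polynomial, which therefore may replace $T_k(A,B)$ in $(*)$ and also takes trace class values on $\mathcal B_k(\mathcal H)$: $$\begin{aligned} k=1:\;& 0,\\ k=2:\;& -AB,\\ k=3:\;& -A^2B-AB^2+\tfrac12ABAB,\\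 k=4:\;& -A^3B-AB^3-\tfrac12ABAB-A^2B^2+A^2BAB+AB^2AB-\tfrac13ABABAB,\\ k=5:\;& -A^4B-AB^4-A^3B^2-A^2B^3-A^2BAB-AB^2AB+A^3BAB+AB^3AB\\ &+A^2B^2AB+A^2BAB^2+\tfrac23ABABAB+\tfrac12A^2BA^2B+\tfrac12AB^2AB^2\\ &-A^2BABAB-AB^2ABAB+\tfrac14ABABABAB. \end{aligned}$$ -/

import Mathlib

open Filter Topology

namespace SchattenDet

section Operators

variable {H : Type*} [NormedAddCommGroup H] [InnerProductSpace ℂ H]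

/-- The singular numbers `s₀(T) ≥ s₁(T) ≥ …` of a bounded operator on a Hilbert space:
`sₙ(T)` is the distance, in operator norm, from `T` to the operators of rank at most `n`.
For compact `T` this is the `n`-th eigenvalue of `|T|`, counted from `0` in decreasing order
with multiplicity; for non-compact `T` it does not tend to `0`. -/
noncomputable def singularNumber (T : H →L[ℂ] H) (n : ℕ) : ℝ :=
  sInf {r : ℝ | ∃ F : H →L[ℂ] H, LinearMap.rank (F : H →ₗ[ℂ] H) ≤ (n : Cardinal) ∧ r = ‖T - F‖}

/-- The Schatten--von Neumann class `B_k(H)`, `k ≥ 1`: the `k`-th powers of the singular numbers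
are summable (such a `T` is automatically compact). -/
def IsSchatten (k : ℕ) (T : H →L[ℂ] H) : Prop :=
  Summable fun n : ℕ => singularNumber T n ^ k

/-- The trace class `B_1(H)`. -/
def IsTraceClass (T : H →L[ℂ] H) : Prop := IsSchatten 1 T

variable [CompleteSpace H]

variable (H) in
/-- The index set of a fixed orthonormal (Hilbert) basis of `H`. -/
noncomputable def basisSet : Set H := Classical.choose (exists_hilbertBasis ℂ H)

variable (H) in
/-- A fixed orthonormal (Hilbert) basis of `H`. -/
noncomputable def onb : HilbertBasis (basisSet H) ℂ H :=
  Classical.choose (Classical.choose_spec (exists_hilbertBasis ℂ H))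

/-- The matrix entries `(e_i, T e_j)` of `T` in the fixed orthonormal basis. -/
noncomputable def entry (T : H →L[ℂ] H) (i j : basisSet H) : ℂ :=
  inner ℂ (onb H i) (T (onb H j))

/-- The trace `∑ i, (e_i, T e_i)`; for trace class `T` the sum converges absolutely and its value
does not depend on the basis. -/
noncomputable def trace (T : H →L[ℂ] H) : ℂ := ∑' i, entry T i i

open Classical in
/-- The determinant of the compression of `Y` to the span of `{e_i | i ∈ s}`. -/
noncomputable def compressionDet (Y : H →L[ℂ] H) (s : Finset (basisSet H)) : ℂ :=
  Matrix.det (Matrix.of fun i j : s => entry Y i j)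

/-- The Fredholm determinant `det(Y)` of an operator `Y = I + S` with `S` of trace class: the limit
of the determinants of the compressions `I + P S P` of `Y` to the finite-dimensional coordinate
subspaces of the basis. -/
noncomputable def fredholmDet (Y : H →L[ℂ] H) : ℂ :=
  limUnder atTop (compressionDet Y)

/-- For `X = I - A`, the operator `(I - A) exp(∑_{j=1}^{k-1} A^j / j)`; it differs from `I` by a
trace class operator when `A ∈ B_k(H)`. -/
noncomputable def regularize (k : ℕ) (X : H →L[ℂ] H) : H →L[ℂ] H :=
  X * NormedSpace.exp (∑ j ∈ Finset.Icc 1 (k - 1), (1 / (j : ℂ)) • (1 - X) ^ j)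

/-- The modified (regularized) Fredholm determinant `det_k(X)` for `X ∈ I + B_k(H)`, namely
`det_k(I - A) = det((I - A) exp(∑_{j=1}^{k-1} A^j / j))`. -/
noncomputable def detk (k : ℕ) (X : H →L[ℂ] H) : ℂ :=
  fredholmDet (regularize k X)

end Operators

section Polynomials

/-- Polynomials with complex coefficients in two non-commuting variables. -/
abbrev NCPoly : Type := FreeAlgebra ℂ (Fin 2)

/-- The first variable. -/
abbrev varA : NCPoly := FreeAlgebra.ι ℂ 0

/-- The second variable. -/
abbrev varB : NCPoly := FreeAlgebra.ι ℂ 1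

/-- The monomial given by a word in the two variables. -/
def word (l : List (Fin 2)) : NCPoly := (l.map (FreeAlgebra.ι ℂ)).prod

/-- All terms of `p` have degree exactly `m`. -/
def IsHomogeneousOfDegree (m : ℕ) (p : NCPoly) : Prop :=
  p ∈ Submodule.span ℂ {q : NCPoly | ∃ l : List (Fin 2), l.length = m ∧ q = word l}

/-- All terms of `p` have degree at least `m`. -/
def HasTermsOfDegreeGE (m : ℕ) (p : NCPoly) : Prop :=
  p ∈ Submodule.span ℂ {q : NCPoly | ∃ l : List (Fin 2), m ≤ l.length ∧ q = word l}

/-- `p` and `q` agree up to cyclic permutations of their terms: `p - q` is a linear combination of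
differences of two words that are cyclic permutations of each other. -/
def CyclicEquiv (p q : NCPoly) : Prop :=
  p - q ∈ Submodule.span ℂ
    {r : NCPoly | ∃ l l' : List (Fin 2), List.IsRotated l l' ∧ r = word l - word l'}

/-- The value `p(A, B)` of a non-commutative polynomial at two bounded operators. -/
noncomputable def eval {H : Type*} [NormedAddCommGroup H] [InnerProductSpace ℂ H]
    (A B : H →L[ℂ] H) (p : NCPoly) : H →L[ℂ] H :=
  FreeAlgebra.lift ℂ ![A, B] p

open Polynomial in
/-- The polynomial `∑_{j=1}^{k-1} (1/j) ((tA + tB - t²AB)^j - (tA)^j - (tB)^j)` in the central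
variable `t`, with coefficients in the polynomials in the non-commuting variables `A`, `B`. -/
noncomputable def generating (k : ℕ) : Polynomial NCPoly :=
  ∑ j ∈ Finset.Icc 1 (k - 1), (1 / (j : ℂ)) •
    ((C varA * X + C varB * X - C (varA * varB) * X ^ 2) ^ j
      - (C varA * X) ^ j - (C varB * X) ^ j)

/-- `P_m(A, B)`: the coefficient of `t ^ m` (for the given `k`). -/
noncomputable def P (k m : ℕ) : NCPoly := (generating k).coeff m

/-- `T_k(A, B) = ∑_{m=k}^{2k-2} P_m(A, B)`. -/
noncomputable def T (k : ℕ) : NCPoly := ∑ m ∈ Finset.Icc k (2 * k - 2), P k m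

/-- The explicit simplified polynomials for `k = 1, …, 5` (the value at other `k` is not used). -/
noncomputable def explicitT : ℕ → NCPoly
  | 2 => -(varA * varB)
  | 3 => -(varA ^ 2 * varB) - varA * varB ^ 2 + (1 / 2 : ℂ) • (varA * varB * varA * varB)
  | 4 => -(varA ^ 3 * varB) - varA * varB ^ 3 - (1 / 2 : ℂ) • (varA * varB * varA * varB)
      - varA ^ 2 * varB ^ 2 + varA ^ 2 * varB * varA * varB + varA * varB ^ 2 * varA * varB
      - (1 / 3 : ℂ) • (varA * varB * varA * varB * varA * varB)
  | 5 => -(varA ^ 4 * varB) - varA * varB ^ 4 - varA ^ 3 * varB ^ 2 - varA ^ 2 * varB ^ 3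
      - varA ^ 2 * varB * varA * varB - varA * varB ^ 2 * varA * varB
      + varA ^ 3 * varB * varA * varB + varA * varB ^ 3 * varA * varB
      + varA ^ 2 * varB ^ 2 * varA * varB + varA ^ 2 * varB * varA * varB ^ 2
      + (2 / 3 : ℂ) • (varA * varB * varA * varB * varA * varB)
      + (1 / 2 : ℂ) • (varA ^ 2 * varB * varA ^ 2 * varB)
      + (1 / 2 : ℂ) • (varA * varB ^ 2 * varA * varB ^ 2)
      - varA ^ 2 * varB * varA * varB * varA * varB - varA * varB ^ 2 * varA * varB * varA * varB
      + (1 / 4 : ℂ) • (varA * varB * varA * varB * varA * varB * varA * varB)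
  | _ => 0

end Polynomials

/-- The polynomial `Q` takes trace class values on `B_k(H)` and satisfies
`det_k((I-A)(I-B)) = det_k(I-A) det_k(I-B) exp(tr Q(A,B))` for all `A, B ∈ B_k(H)`. -/
def IsDetCorrection (H : Type*) [NormedAddCommGroup H] [InnerProductSpace ℂ H] [CompleteSpace H]
    (k : ℕ) (Q : NCPoly) : Prop :=
  ∀ A B : H →L[ℂ] H, IsSchatten k A → IsSchatten k B →
    IsTraceClass (eval A B Q) ∧
    detk k ((1 - A) * (1 - B)) =
      detk k (1 - A) * detk k (1 - B) * Complex.exp (trace (eval A B Q))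

end SchattenDet

open SchattenDet

/-! Everything is reduced to finite matrices. Let `trunc s A` be the compression of A to the span of
finitely many basis vectors. Its singular numbers are dominated by those of A, and it tends to A in
norm because A is a norm limit of finite rank operators (`tendsto_trunc`).

For matrices, det_k(I-A) = det(I-A) exp(tr ∑_{j<k} A^j/j). Multiplicativity of det therefore gives
the formula with the trace of the full sum of all P_m (`compressionDet_regularize_mul`). The terms
with m < k have trace zero: for zA, zB each of the three determinants is 1 + O(z^k), hence so is
exp(∑ z^m tr P_m), and its low coefficients vanish (`trace_compression_eval_P_eq_zero`).

The passage to the limit needs continuity of determinant and trace. The substitute for the trace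
norm is the sum of the singular numbers, combined with dominated convergence under a common majorant
(`UnifSchatten`). A min-max argument bounds compressed determinants of I+S by exp(∑ s_n(S)).
Cauchy's estimate, applied to determinants along complex lines, turns this bound into Lipschitz
bounds for determinants and into bounds for partial traces. The regularized operator minus I factors
as A^k G with G bounded (`one_sub_mul_exp_logSum`), which makes it trace class and gives the order
z^k above.

For uniqueness, scaling by z shows that the difference of two admissible polynomials has trace zero
in each degree on finite rank operators. Testing on matrix units placed along a cycle labelled by a
word w (`cyclicShift`), the trace of a word of the same length counts the rotations of w equal to
it. So the coefficients sum to zero over rotations, which is cyclic equivalence to 0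
(`sum_word_mem_cyclicSpan`). The explicit polynomials are checked by an integer computation on lists
of words, after multiplying by 12. -/

namespace SchattenDet

/-! ### Singular numbers as approximation numbers. -/

section SingularNumbers

variable {H : Type*} [NormedAddCommGroup H] [InnerProductSpace ℂ H]

theorem singularNumber_bddBelow (T : H →L[ℂ] H) (n : ℕ) :
    BddBelow {r : ℝ | ∃ F : H →L[ℂ] H,
      LinearMap.rank (F : H →ₗ[ℂ] H) ≤ (n : Cardinal) ∧ r = ‖T - F‖} :=
  ⟨0, by rintro r ⟨F, -, rfl⟩; exact norm_nonneg _⟩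

theorem singularNumber_nonempty (T : H →L[ℂ] H) (n : ℕ) :
    {r : ℝ | ∃ F : H →L[ℂ] H,
      LinearMap.rank (F : H →ₗ[ℂ] H) ≤ (n : Cardinal) ∧ r = ‖T - F‖}.Nonempty :=
  ⟨‖T - 0‖, 0, by simp [LinearMap.rank_zero], rfl⟩

theorem singularNumber_nonneg (T : H →L[ℂ] H) (n : ℕ) : 0 ≤ singularNumber T n :=
  Real.sInf_nonneg (by rintro r ⟨F, -, rfl⟩; exact norm_nonneg _)

theorem singularNumber_le_norm_sub (T F : H →L[ℂ] H) {n : ℕ}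
    (hF : LinearMap.rank (F : H →ₗ[ℂ] H) ≤ (n : Cardinal)) : singularNumber T n ≤ ‖T - F‖ :=
  csInf_le (singularNumber_bddBelow T n) ⟨F, hF, rfl⟩

theorem exists_norm_sub_lt (T : H →L[ℂ] H) (n : ℕ) {c : ℝ} (hc : singularNumber T n < c) :
    ∃ F : H →L[ℂ] H, LinearMap.rank (F : H →ₗ[ℂ] H) ≤ (n : Cardinal) ∧ ‖T - F‖ < c := by
  obtain ⟨r, ⟨F, hF, rfl⟩, hr⟩ := exists_lt_of_csInf_lt (singularNumber_nonempty T n) hc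
  exact ⟨F, hF, hr⟩

theorem singularNumber_le_norm (T : H →L[ℂ] H) (n : ℕ) : singularNumber T n ≤ ‖T‖ := by
  simpa using singularNumber_le_norm_sub T 0 (n := n) (by simp [LinearMap.rank_zero])

theorem singularNumber_antitone (T : H →L[ℂ] H) : Antitone (singularNumber T) := by
  intro m n h
  refine le_of_forall_gt fun c hc => ?_
  obtain ⟨F, hF, hr⟩ := exists_norm_sub_lt T m hc
  exact (singularNumber_le_norm_sub T F (hF.trans (by exact_mod_cast h))).trans_lt hr

theorem singularNumber_add_le (S T : H →L[ℂ] H) (m n : ℕ) :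
    singularNumber (S + T) (m + n) ≤ singularNumber S m + singularNumber T n := by
  refine le_of_forall_pos_le_add fun ε hε => ?_
  obtain ⟨F, hF, hF'⟩ := exists_norm_sub_lt S m (lt_add_of_pos_right _ (half_pos hε))
  obtain ⟨G, hG, hG'⟩ := exists_norm_sub_lt T n (lt_add_of_pos_right _ (half_pos hε))
  have h := singularNumber_le_norm_sub (S + T) (F + G) (n := m + n) (by
    push_cast
    exact (LinearMap.rank_add_le _ _).trans (add_le_add hF hG))
  have h2 : ‖S + T - (F + G)‖ ≤ ‖S - F‖ + ‖T - G‖ := by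
    rw [add_sub_add_comm]; exact norm_add_le _ _
  linarith

theorem singularNumber_mul_le (S T : H →L[ℂ] H) (m n : ℕ) :
    singularNumber (S * T) (m + n) ≤ singularNumber S m * singularNumber T n := by
  have key : ∀ a b : ℝ, singularNumber S m < a → singularNumber T n < b →
      singularNumber (S * T) (m + n) ≤ a * b := by
    intro a b ha hb
    obtain ⟨F, hF, hF'⟩ := exists_norm_sub_lt S m ha
    obtain ⟨G, hG, hG'⟩ := exists_norm_sub_lt T n hb
    -- This approximant has rank at most m + n, and its error factors as (S - F)(T - G).
    have h := singularNumber_le_norm_sub (S * T) (F * T + (S - F) * G) (n := m + n) (by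
      push_cast
      refine (LinearMap.rank_add_le _ _).trans (add_le_add ?_ ?_)
      · exact (LinearMap.rank_comp_le_left _ _).trans hF
      · exact (LinearMap.rank_comp_le_right _ _).trans hG)
    have h2 : S * T - (F * T + (S - F) * G) = (S - F) * (T - G) := by noncomm_ring
    rw [h2] at h
    exact h.trans ((norm_mul_le _ _).trans
      (mul_le_mul hF'.le hG'.le (norm_nonneg _) ((norm_nonneg _).trans hF'.le)))
  have hlim : Tendsto (fun ε : ℝ => (singularNumber S m + ε) * (singularNumber T n + ε))
      (𝓝[>] 0) (𝓝 (singularNumber S m * singularNumber T n)) := by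
    have : Continuous fun ε : ℝ => (singularNumber S m + ε) * (singularNumber T n + ε) := by
      fun_prop
    simpa using (this.tendsto 0).mono_left nhdsWithin_le_nhds
  refine ge_of_tendsto hlim ?_
  filter_upwards [self_mem_nhdsWithin] with ε hε
  exact key _ _ (lt_add_of_pos_right _ hε) (lt_add_of_pos_right _ hε)

theorem singularNumber_mul_le_mul_norm (S T : H →L[ℂ] H) (n : ℕ) :
    singularNumber (S * T) n ≤ singularNumber S n * ‖T‖ :=
  (singularNumber_mul_le S T n 0).trans
    (mul_le_mul_of_nonneg_left (singularNumber_le_norm T 0) (singularNumber_nonneg S n))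

theorem singularNumber_mul_le_norm_mul (S T : H →L[ℂ] H) (n : ℕ) :
    singularNumber (S * T) n ≤ ‖S‖ * singularNumber T n := by
  have := singularNumber_mul_le S T 0 n
  rw [zero_add] at this
  exact this.trans
    (mul_le_mul_of_nonneg_right (singularNumber_le_norm S 0) (singularNumber_nonneg T n))

/-- Only an inequality, since H may be zero. -/
theorem norm_one_clm_le : ‖(1 : H →L[ℂ] H)‖ ≤ 1 := ContinuousLinearMap.norm_id_le

theorem singularNumber_smul_le (c : ℂ) (T : H →L[ℂ] H) (n : ℕ) :
    singularNumber (c • T) n ≤ ‖c‖ * singularNumber T n := by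
  have h := singularNumber_mul_le_norm_mul (c • (1 : H →L[ℂ] H)) T n
  rw [smul_mul_assoc, one_mul] at h
  refine h.trans (mul_le_mul_of_nonneg_right ?_ (singularNumber_nonneg T n))
  exact (norm_smul_le _ _).trans (mul_le_of_le_one_right (norm_nonneg _) norm_one_clm_le)

theorem singularNumber_list_prod_le {b : ℝ} (n : ℕ) (L : List (H →L[ℂ] H))
    (hL : ∀ X ∈ L, singularNumber X n ≤ b) :
    singularNumber L.prod (L.length * n) ≤ b ^ L.length := by
  induction L with
  | nil => simpa using (singularNumber_le_norm (1 : H →L[ℂ] H) 0).trans norm_one_clm_le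
  | cons X L ih =>
    rw [List.prod_cons, List.length_cons, pow_succ', add_mul, one_mul, add_comm]
    have hX := hL X (by simp)
    exact (singularNumber_mul_le _ _ _ _).trans (mul_le_mul hX
      (ih fun Y hY => hL Y (List.mem_cons_of_mem _ hY)) (singularNumber_nonneg _ _)
      ((singularNumber_nonneg _ _).trans hX))

theorem norm_le_singularNumber_zero (T : H →L[ℂ] H) : ‖T‖ ≤ singularNumber T 0 := by
  refine le_csInf (singularNumber_nonempty T 0) ?_
  rintro r ⟨F, hF, rfl⟩
  have hrange : LinearMap.range (F : H →ₗ[ℂ] H) = ⊥ := by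
    rw [← Submodule.rank_eq_zero]
    simpa [LinearMap.rank] using hF
  have hF0 : F = 0 := by
    ext x
    simpa using LinearMap.congr_fun (LinearMap.range_eq_bot.1 hrange) x
  rw [hF0, sub_zero]

end SingularNumbers

/-! ### Schatten classes with a common majorant of singular numbers. -/

section Domination

/-- Each value is repeated d times. The inequalities for s_{m+n} control the n-th singular number of
a sum or product of d operators only through index n / d. -/
theorem hasSum_comp_div {f : ℕ → ℝ} {a : ℝ} (d : ℕ) [NeZero d] (hf : HasSum f a) :
    HasSum (fun m => f (m / d)) (d * a) := by
  rw [← (Nat.divModEquiv d).symm.hasSum_iff]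
  have : (fun m => f (m / d)) ∘ (Nat.divModEquiv d).symm = fun p : ℕ × Fin d => f p.1 := by
    funext p
    have : (p.1 * d + p.2) / d = p.1 := by
      rw [mul_comm, Nat.mul_add_div (NeZero.pos d), Nat.div_eq_of_lt p.2.2, add_zero]
    simp [Nat.divModEquiv, this]
  rw [this]
  have hg : HasSum (fun _ : Fin d => (1 : ℝ)) d := by simpa using hasSum_fintype fun _ : Fin d => (1 : ℝ)
  simpa [mul_comm] using
    hf.mul hg (summable_mul_of_summable_norm hf.summable.norm hg.summable.norm)

theorem summable_comp_div {f : ℕ → ℝ} (d : ℕ) [NeZero d] (hf : Summable f) :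
    Summable (fun m => f (m / d)) :=
  (hasSum_comp_div d hf.hasSum).summable

theorem summable_pow_of_le {b : ℕ → ℝ} {k m : ℕ} (hk : 1 ≤ k) (hkm : k ≤ m)
    (hb : ∀ n, 0 ≤ b n) (h : Summable fun n => b n ^ k) : Summable fun n => b n ^ m := by
  have h0 : ∀ᶠ n in atTop, b n ^ k < 1 := h.tendsto_atTop_zero.eventually (gt_mem_nhds one_pos)
  refine Summable.of_norm_bounded_eventually_nat h ?_
  filter_upwards [h0] with n hn
  rw [Real.norm_of_nonneg (pow_nonneg (hb n) m)]
  refine pow_le_pow_of_le_one (hb n) ?_ hkm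
  exact ((pow_lt_one_iff_of_nonneg (hb n) (by omega)).1 hn).le

variable {H : Type*} [NormedAddCommGroup H] [InnerProductSpace ℂ H] {ι : Type*}

/-- The family `X` is bounded in `B_k(H)` in the strong sense that its singular numbers have a
common majorant whose `k`-th powers are summable. -/
def UnifSchatten (k : ℕ) (X : ι → H →L[ℂ] H) : Prop :=
  ∃ b : ℕ → ℝ, (∀ n, 0 ≤ b n) ∧ (Summable fun n => b n ^ k) ∧ ∀ i n, singularNumber (X i) n ≤ b n

theorem IsSchatten.unif {k : ℕ} {T : H →L[ℂ] H} (h : IsSchatten k T) :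
    UnifSchatten k (fun _ : ι => T) :=
  ⟨singularNumber T, singularNumber_nonneg T, h, fun _ _ => le_rfl⟩

theorem UnifSchatten.isSchatten {k : ℕ} {X : ι → H →L[ℂ] H} (h : UnifSchatten k X) (i : ι) :
    IsSchatten k (X i) := by
  obtain ⟨b, -, hb, hX⟩ := h
  exact Summable.of_nonneg_of_le (fun n => pow_nonneg (singularNumber_nonneg _ _) k)
    (fun n => pow_le_pow_left₀ (singularNumber_nonneg _ _) (hX i n) k) hb

theorem summable_add_pow {b c : ℕ → ℝ} {k : ℕ} (hb0 : ∀ n, 0 ≤ b n) (hc0 : ∀ n, 0 ≤ c n)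
    (hb : Summable fun n => b n ^ k) (hc : Summable fun n => c n ^ k) :
    Summable fun n => (b n + c n) ^ k :=
  Summable.of_nonneg_of_le (fun n => pow_nonneg (add_nonneg (hb0 n) (hc0 n)) k)
    (fun n => add_pow_le (hb0 n) (hc0 n) k) ((hb.add hc).mul_left _)

theorem UnifSchatten.add {k : ℕ} {X Y : ι → H →L[ℂ] H} (hX : UnifSchatten k X)
    (hY : UnifSchatten k Y) : UnifSchatten k (fun i => X i + Y i) := by
  obtain ⟨b, hb0, hb, hXb⟩ := hX
  obtain ⟨c, hc0, hc, hYc⟩ := hY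
  refine ⟨fun n => b (n / 2) + c (n / 2), fun n => add_nonneg (hb0 _) (hc0 _), ?_, fun i n => ?_⟩
  · exact summable_comp_div (f := fun n => (b n + c n) ^ k) 2 (summable_add_pow hb0 hc0 hb hc)
  · exact (singularNumber_antitone _ (by omega : n / 2 + n / 2 ≤ n)).trans
      ((singularNumber_add_le _ _ _ _).trans (add_le_add (hXb _ _) (hYc _ _)))

theorem UnifSchatten.of_le {κ : Type*} {k : ℕ} {X : ι → H →L[ℂ] H} (hX : UnifSchatten k X)
    {Y : κ → H →L[ℂ] H} {C : ℝ} (hC : 0 ≤ C)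
    (hY : ∀ j, ∃ i, ∀ n, singularNumber (Y j) n ≤ C * singularNumber (X i) n) :
    UnifSchatten k Y := by
  obtain ⟨b, hb0, hb, hXb⟩ := hX
  refine ⟨fun n => C * b n, fun n => mul_nonneg hC (hb0 n), ?_, fun j n => ?_⟩
  · simpa [mul_pow] using hb.mul_left (C ^ k)
  · obtain ⟨i, hi⟩ := hY j
    exact (hi n).trans (mul_le_mul_of_nonneg_left (hXb i n) hC)

theorem UnifSchatten.smul {k : ℕ} {X : ι → H →L[ℂ] H} (hX : UnifSchatten k X) (c : ℂ) :
    UnifSchatten k (fun i => c • X i) :=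
  hX.of_le (norm_nonneg c) fun i => ⟨i, singularNumber_smul_le c (X i)⟩

theorem UnifSchatten.sub {k : ℕ} {X Y : ι → H →L[ℂ] H} (hX : UnifSchatten k X)
    (hY : UnifSchatten k Y) : UnifSchatten k (fun i => X i - Y i) := by
  simpa [sub_eq_add_neg] using hX.add (hY.smul (-1))

theorem UnifSchatten.mul_bounded {k : ℕ} {X Y : ι → H →L[ℂ] H} (hX : UnifSchatten k X) {C : ℝ}
    (hY : ∀ i, ‖Y i‖ ≤ C) (hC : 0 ≤ C) : UnifSchatten k (fun i => X i * Y i) :=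
  hX.of_le hC fun i => ⟨i, fun n => by
    rw [mul_comm]
    exact (singularNumber_mul_le_mul_norm _ _ n).trans
      (mul_le_mul_of_nonneg_left (hY i) (singularNumber_nonneg _ _))⟩

theorem UnifSchatten.zero {k : ℕ} (hk : 1 ≤ k) : UnifSchatten k (fun _ : ι => (0 : H →L[ℂ] H)) := by
  refine ⟨fun _ => 0, fun _ => le_rfl, ?_, fun _ n => ?_⟩
  · simp [zero_pow (by omega : k ≠ 0), summable_zero]
  · simpa using singularNumber_le_norm (0 : H →L[ℂ] H) n

theorem UnifSchatten.sum {κ : Type*} {k : ℕ} (hk : 1 ≤ k) (s : Finset κ) {X : κ → ι → H →L[ℂ] H}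
    (h : ∀ j ∈ s, UnifSchatten k (X j)) : UnifSchatten k (fun i => ∑ j ∈ s, X j i) := by
  classical
  induction s using Finset.induction_on with
  | empty => simpa using UnifSchatten.zero hk
  | insert a s ha ih =>
    simp only [Finset.sum_insert ha]
    exact (h a (by simp)).add (ih fun j hj => h j (by simp [hj]))

/-- Takes the place of Hölder's inequality: the n-th singular number of a product of m factors is at
most b(n/m)^m, which is summable because m ≥ k. -/
theorem UnifSchatten.list_prod {k m : ℕ} (hk : 1 ≤ k) (hkm : k ≤ m) {b : ℕ → ℝ}
    (hb0 : ∀ n, 0 ≤ b n) (hb : Summable fun n => b n ^ k) (L : ι → List (H →L[ℂ] H))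
    (hlen : ∀ i, (L i).length = m) (hL : ∀ i, ∀ X ∈ L i, ∀ n, singularNumber X n ≤ b n) :
    UnifSchatten 1 (fun i => (L i).prod) := by
  have : NeZero m := ⟨by omega⟩
  refine ⟨fun n => b (n / m) ^ m, fun n => pow_nonneg (hb0 _) _, ?_, fun i n => ?_⟩
  · simpa using summable_comp_div (f := fun n => b n ^ m) m (summable_pow_of_le hk hkm hb0 hb)
  · have h := singularNumber_list_prod_le (n / m) (L i) (b := b (n / m)) fun X hX => hL i X hX _
    rw [hlen] at h
    exact (singularNumber_antitone _ (Nat.mul_div_le n m)).trans h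

theorem UnifSchatten.pow {k : ℕ} (hk : 1 ≤ k) {X : ι → H →L[ℂ] H} (hX : UnifSchatten k X) :
    UnifSchatten 1 (fun i => X i ^ k) := by
  obtain ⟨b, hb0, hb, hXb⟩ := hX
  have := UnifSchatten.list_prod hk le_rfl hb0 hb (fun i => List.replicate k (X i))
    (fun i => List.length_replicate) (fun i Y hY n => by
      rw [List.eq_of_mem_replicate hY]; exact hXb i n)
  simpa using this

/-- The trace norm, up to a constant: the sum of the singular numbers. -/
noncomputable def singularSum (T : H →L[ℂ] H) : ℝ := ∑' n, singularNumber T n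

theorem IsTraceClass.summable {T : H →L[ℂ] H} (h : IsTraceClass T) :
    Summable (singularNumber T) := by
  simpa [IsTraceClass, IsSchatten] using h

theorem singularSum_nonneg (T : H →L[ℂ] H) : 0 ≤ singularSum T :=
  tsum_nonneg (singularNumber_nonneg T)

theorem IsTraceClass.add {S T : H →L[ℂ] H} (hS : IsTraceClass S) (hT : IsTraceClass T) :
    IsTraceClass (S + T) :=
  ((IsSchatten.unif (ι := Unit) hS).add (IsSchatten.unif hT)).isSchatten ()

theorem IsTraceClass.smul {T : H →L[ℂ] H} (hT : IsTraceClass T) (c : ℂ) :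
    IsTraceClass (c • T) :=
  ((IsSchatten.unif (ι := Unit) hT).smul c).isSchatten ()

/-- The factor 2 is the repetition of each index in s_n(S+T) ≤ s_{n/2}(S) + s_{n/2}(T). This
quasi-triangle inequality suffices for all later estimates. -/
theorem singularSum_add_le {S T : H →L[ℂ] H} (hS : IsTraceClass S) (hT : IsTraceClass T) :
    singularSum (S + T) ≤ 2 * (singularSum S + singularSum T) := by
  have h := hasSum_comp_div 2 (hS.summable.add hT.summable).hasSum
  rw [hS.summable.tsum_add hT.summable] at h
  refine (hasSum_le (fun n => ?_) (hS.add hT).summable.hasSum h).trans_eq (by simp [singularSum])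
  exact (singularNumber_antitone _ (by omega : n / 2 + n / 2 ≤ n)).trans
    (singularNumber_add_le _ _ _ _)

theorem singularSum_smul_le {T : H →L[ℂ] H} (hT : IsTraceClass T) (c : ℂ) :
    singularSum (c • T) ≤ ‖c‖ * singularSum T := by
  rw [singularSum, singularSum, ← tsum_mul_left]
  exact (hT.smul c).summable.tsum_le_tsum (singularNumber_smul_le c T) (hT.summable.mul_left _)

/-- Norm convergence gives termwise convergence of singular numbers, and the majorant permits
dominated convergence. -/
theorem tendsto_singularSum {X : ι → H →L[ℂ] H} {l : Filter ι} (hX : UnifSchatten 1 X)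
    (h0 : Tendsto X l (𝓝 0)) : Tendsto (fun i => singularSum (X i)) l (𝓝 0) := by
  obtain ⟨b, hb0, hb, hXb⟩ := hX
  have h := tendsto_tsum_of_dominated_convergence (f := fun i n => singularNumber (X i) n)
    (g := fun _ => (0 : ℝ)) (𝓕 := l) (bound := b) (by simpa using hb) (fun n => ?_) ?_
  · simpa [singularSum] using h
  · refine squeeze_zero (fun i => singularNumber_nonneg _ _)
      (fun i => singularNumber_le_norm (X i) n) ?_
    simpa using h0.norm
  · refine Eventually.of_forall fun i n => ?_
    rw [Real.norm_of_nonneg (singularNumber_nonneg _ _)]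
    exact hXb i n

end Domination

/-! ### A min-max bound for singular values of matrices. -/

section SingularValues

open Module

variable {E : Type*} [NormedAddCommGroup E] [InnerProductSpace ℂ E] [FiniteDimensional ℂ E]

/-- One half of Courant–Fischer: the kernel of F has codimension at most n, so it meets the span of
the top n + 1 eigenvectors of f*f, where ‖f v‖ is at least the n-th singular value times ‖v‖. -/
theorem singularValues_le_of_forall_ker {V : Type*} [AddCommGroup V] [Module ℂ V]
    (f : E →ₗ[ℂ] E) (F : E →ₗ[ℂ] V) {n : ℕ} {c : ℝ} (hc : 0 ≤ c)
    (hF : LinearMap.rank F ≤ (n : Cardinal)) (h : ∀ v, F v = 0 → ‖f v‖ ≤ c * ‖v‖) :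
    f.singularValues n ≤ c := by
  rcases le_or_gt (finrank ℂ E) n with hn | hn
  · rw [f.singularValues_of_finrank_le hn]; exact hc
  have hfin : FiniteDimensional ℂ (LinearMap.range F) :=
    Module.rank_lt_aleph0_iff.1 (hF.trans_lt (Cardinal.natCast_lt_aleph0))
  have hrk : finrank ℂ (LinearMap.range F) ≤ n := Module.finrank_le_of_rank_le hF
  set T := f.adjoint ∘ₗ f with hT
  set u := f.isSymmetric_adjoint_comp_self.eigenvectorBasis (n := finrank ℂ E) rfl with hu
  set μ := f.isSymmetric_adjoint_comp_self.eigenvalues (n := finrank ℂ E) rfl with hμ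
  -- G collects the coordinates along eigenvectors of index above n. Together F and G impose at most
  -- dim E - 1 conditions, so a common non-zero kernel vector exists.
  let G : E →ₗ[ℂ] (Fin (finrank ℂ E - 1 - n) → ℂ) :=
    LinearMap.pi fun i => (innerₛₗ ℂ (u ⟨n + 1 + i, by omega⟩))
  have hker : LinearMap.ker (F.rangeRestrict.prod G) ≠ ⊥ := by
    apply LinearMap.ker_ne_bot_of_finrank_lt
    rw [finrank_prod, finrank_fin_fun]
    omega
  obtain ⟨v, hv, hv0⟩ := (Submodule.ne_bot_iff _).1 hker
  have hv1 : F.rangeRestrict v = 0 := congrArg Prod.fst (LinearMap.mem_ker.1 hv)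
  have hv2 : G v = 0 := congrArg Prod.snd (LinearMap.mem_ker.1 hv)
  have hFv : F v = 0 := by simpa using congrArg Subtype.val hv1
  have hGv : ∀ i : Fin (finrank ℂ E), n < i → inner ℂ (u i) v = 0 := fun i hi => by
    have := congrFun hv2 ⟨i - (n + 1), by omega⟩
    simpa [G, show n + 1 + ((i : ℕ) - (n + 1)) = i by omega] using this
  have hsq : ‖f v‖ ^ 2 = ∑ i, μ i * ‖inner ℂ (u i) v‖ ^ 2 := by
    have h1 : inner ℂ (f v) (f v) = inner ℂ v (T v) := by
      rw [hT, LinearMap.comp_apply, LinearMap.adjoint_inner_right]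
    rw [← u.sum_inner_mul_inner v (T v)] at h1
    have h2 : ∀ i, inner ℂ (u i) (T v) = μ i * inner ℂ (u i) v := fun i => by
      have := f.isSymmetric_adjoint_comp_self.eigenvectorBasis_apply_self_apply rfl v i
      rwa [OrthonormalBasis.repr_apply_apply, OrthonormalBasis.repr_apply_apply] at this
    simp_rw [h2] at h1
    have h3 : ((‖f v‖ ^ 2 : ℝ) : ℂ) = ((∑ i, μ i * ‖inner ℂ (u i) v‖ ^ 2 : ℝ) : ℂ) := by
      push_cast
      rw [inner_self_eq_norm_sq_to_K] at h1
      refine h1.trans (Finset.sum_congr rfl fun i _ => ?_)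
      rw [mul_left_comm, ← inner_conj_symm v, mul_comm (starRingEnd ℂ _), Complex.mul_conj,
        Complex.normSq_eq_norm_sq]
      push_cast; rfl
    exact_mod_cast h3
  have hle : μ ⟨n, hn⟩ * ‖v‖ ^ 2 ≤ ‖f v‖ ^ 2 := by
    rw [hsq, ← u.sum_sq_norm_inner_right, Finset.mul_sum]
    refine Finset.sum_le_sum fun i _ => ?_
    rcases lt_or_ge n i with hi | hi
    · simp [hGv i hi]
    · exact mul_le_mul_of_nonneg_right
        (f.isSymmetric_adjoint_comp_self.eigenvalues_antitone rfl (Fin.mk_le_mk.2 hi)) (by positivity)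
  have hvpos : 0 < ‖v‖ ^ 2 := by positivity
  have hfv : ‖f v‖ ^ 2 ≤ c ^ 2 * ‖v‖ ^ 2 := by
    rw [← mul_pow]; exact pow_le_pow_left₀ (norm_nonneg _) (h v hFv) 2
  refine le_of_sq_le_sq ?_ hc
  rw [f.sq_singularValues_of_lt rfl hn]
  exact le_of_mul_le_mul_right (hle.trans hfv) hvpos

theorem norm_det_le_prod (f : E →ₗ[ℂ] E) (c : ℕ → ℝ) (h : ∀ n, f.singularValues n ≤ c n) :
    ‖LinearMap.det f‖ ≤ ∏ n ∈ Finset.range (finrank ℂ E), c n := by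
  rw [← f.normDet_eq_norm_det, f.normDet_eq_prod_singularValues]
  exact Finset.prod_le_prod (fun i _ => f.singularValues_nonneg i) fun i _ => h i

end SingularValues

/-! ### Compressions to coordinate subspaces and the exponential bound on their determinants. -/

section Compression

variable {H : Type*} [NormedAddCommGroup H] [InnerProductSpace ℂ H] [CompleteSpace H]

/-- The matrix of the compression of `Y` to the span of `{e_i | i ∈ s}`. -/
noncomputable def compression (s : Finset (basisSet H)) : (H →L[ℂ] H) →ₗ[ℂ] Matrix s s ℂ where
  toFun Y := Matrix.of fun i j => entry Y i j
  map_add' X Y := by ext i j; simp [entry]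
  map_smul' c X := by ext i j; simp [entry]

theorem compression_apply (s : Finset (basisSet H)) (Y : H →L[ℂ] H) (i j : s) :
    compression s Y i j = inner ℂ (onb H i) (Y (onb H j)) := rfl

/-- The inclusion of the span of `{e_i | i ∈ s}`, in coordinates. -/
noncomputable def coordIncl (s : Finset (basisSet H)) : EuclideanSpace ℂ s →ₗ[ℂ] H where
  toFun v := ∑ i, v i • onb H i
  map_add' v w := by simp [add_smul, Finset.sum_add_distrib]
  map_smul' c v := by simp [mul_smul, Finset.smul_sum]

theorem orthonormal_onb (s : Finset (basisSet H)) :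
    Orthonormal ℂ (fun i : s => onb H (i : basisSet H)) :=
  (onb H).orthonormal.comp _ Subtype.val_injective

theorem norm_coordIncl (s : Finset (basisSet H)) (v : EuclideanSpace ℂ s) :
    ‖coordIncl s v‖ = ‖v‖ := by
  rw [← sq_eq_sq₀ (norm_nonneg _) (norm_nonneg _), EuclideanSpace.norm_sq_eq]
  have h : ((‖coordIncl s v‖ ^ 2 : ℝ) : ℂ) = ((∑ i, ‖v i‖ ^ 2 : ℝ) : ℂ) := by
    push_cast
    rw [← Complex.coe_algebraMap, ← inner_self_eq_norm_sq_to_K (𝕜 := ℂ) (coordIncl s v)]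
    change inner ℂ (∑ i, v i • onb H i) (∑ i, v i • onb H i) = _
    rw [(orthonormal_onb s).inner_sum]
    exact Finset.sum_congr rfl fun i _ => by
      rw [mul_comm, Complex.mul_conj, Complex.normSq_eq_norm_sq]; push_cast; rfl
  exact_mod_cast h

theorem norm_toLpLin_compression_le (s : Finset (basisSet H)) [DecidableEq s] (Y : H →L[ℂ] H)
    (v : EuclideanSpace ℂ s) :
    ‖Matrix.toLpLin 2 2 (compression s Y) v‖ ≤ ‖Y (coordIncl s v)‖ := by
  rw [← sq_le_sq₀ (norm_nonneg _) (norm_nonneg _), EuclideanSpace.norm_sq_eq]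
  refine le_trans (le_of_eq ?_) ((orthonormal_onb s).sum_inner_products_le (s := Finset.univ) _)
  refine Finset.sum_congr rfl fun i _ => ?_
  congr 2
  change ∑ j, compression s Y i j * v j = inner ℂ _ (Y (∑ j, v j • onb H j))
  simp_rw [map_sum, map_smul, inner_sum, inner_smul_right, compression_apply, mul_comm]

open Classical in
theorem compressionDet_eq (Y : H →L[ℂ] H) (s : Finset (basisSet H)) :
    compressionDet Y s = (compression s Y).det := rfl

/-- On the kernel of a rank n approximant F of S, 1 + S agrees with 1 + (S - F). Hence the
compression has n-th singular value at most 1 + s_n(S) ≤ exp s_n(S), and |det| is the product of the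
singular values. -/
theorem norm_compressionDet_le {S : H →L[ℂ] H} (hS : IsTraceClass S) (s : Finset (basisSet H)) :
    ‖compressionDet (1 + S) s‖ ≤ Real.exp (singularSum S) := by
  classical
  set f := Matrix.toLpLin 2 2 (compression s (1 + S)) with hf
  have hdet : compressionDet (1 + S) s = LinearMap.det f := by
    rw [compressionDet_eq, hf, Matrix.toLpLin_eq_toLin, LinearMap.det_toLin]
  have hsv : ∀ n, f.singularValues n ≤ 1 + singularNumber S n := by
    intro n
    refine le_of_forall_gt fun c hc => ?_
    obtain ⟨F, hF, hF'⟩ := exists_norm_sub_lt S n (lt_sub_iff_add_lt'.2 hc)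
    refine lt_of_le_of_lt (singularValues_le_of_forall_ker f ((F : H →ₗ[ℂ] H) ∘ₗ coordIncl s)
      (c := 1 + ‖S - F‖) (by positivity) ?_ ?_) (by linarith)
    · have : LinearMap.range ((F : H →ₗ[ℂ] H) ∘ₗ coordIncl s) ≤ LinearMap.range (F : H →ₗ[ℂ] H) :=
        LinearMap.range_comp_le_range _ _
      exact (Submodule.rank_mono this).trans hF
    · intro v hv
      refine (norm_toLpLin_compression_le s _ v).trans ?_
      have hv' : F (coordIncl s v) = 0 := hv
      have : (1 + S) (coordIncl s v) = coordIncl s v + (S - F) (coordIncl s v) := by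
        simp [hv']
      rw [this]
      refine (norm_add_le _ _).trans ?_
      rw [add_mul, one_mul, ← norm_coordIncl s v]
      exact add_le_add le_rfl ((S - F).le_opNorm _)
  rw [hdet]
  refine (norm_det_le_prod f _ hsv).trans ?_
  calc ∏ n ∈ Finset.range (Module.finrank ℂ (EuclideanSpace ℂ s)), (1 + singularNumber S n)
      ≤ ∏ n ∈ Finset.range (Module.finrank ℂ (EuclideanSpace ℂ s)), Real.exp (singularNumber S n) :=
        Finset.prod_le_prod (fun i _ => by linarith [singularNumber_nonneg S i])
          fun i _ => by linarith [Real.add_one_le_exp (singularNumber S i)]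
    _ ≤ Real.exp (singularSum S) := by
        rw [← Real.exp_sum]
        exact Real.exp_le_exp.2
          (hS.summable.sum_le_tsum _ fun i _ => singularNumber_nonneg S i)

end Compression

/-! ### Cauchy estimates for determinants and traces. -/

section Estimates

variable {H : Type*} [NormedAddCommGroup H] [InnerProductSpace ℂ H] [CompleteSpace H]

theorem differentiable_det_add_smul {ι : Type*} [Fintype ι] [DecidableEq ι] (M N : Matrix ι ι ℂ) :
    Differentiable ℂ fun z : ℂ => (M + z • N).det := by
  simp only [Matrix.det_apply, Matrix.add_apply, Matrix.smul_apply]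
  fun_prop

theorem hasDerivAt_det_one_add_smul {ι : Type*} [Fintype ι] [DecidableEq ι] (M : Matrix ι ι ℂ) :
    HasDerivAt (fun z : ℂ => (1 + z • M).det) M.trace 0 := by
  have h : (fun z : ℂ => (1 + z • M).det) = fun z =>
      (Matrix.det (1 + (Polynomial.X : Polynomial ℂ) • M.map Polynomial.C)).eval z := by
    funext z
    rw [← Polynomial.coe_evalRingHom, RingHom.map_det]
    congr 1
    ext i j
    by_cases hij : i = j <;> simp [hij, mul_comm z]
  rw [h, ← Matrix.derivative_det_one_add_X_smul]
  exact Polynomial.hasDerivAt _ _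

theorem differentiable_compressionDet (X D : H →L[ℂ] H) (s : Finset (basisSet H)) :
    Differentiable ℂ fun z : ℂ => compressionDet (X + z • D) s := by
  classical
  simp only [compressionDet_eq, map_add, map_smul]
  exact differentiable_det_add_smul _ _

/-- The determinant along S + zD is entire in z. Cauchy's estimate on circles of radius 1/r about
points of the unit disc bounds its derivative by r times the maximum over ‖z‖ ≤ 1 + 1/r, where ‖z‖
`singularSum D` ≤ 1 + r. The mean value inequality from 0 to 1 concludes. -/
theorem norm_compressionDet_sub_le {S D : H →L[ℂ] H} (hS : IsTraceClass S) (hD : IsTraceClass D)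
    {r : ℝ} (hr : 0 < r) (hDr : singularSum D ≤ r) (s : Finset (basisSet H)) :
    ‖compressionDet (1 + (S + D)) s - compressionDet (1 + S) s‖ ≤
      r * Real.exp (2 * (singularSum S + (1 + r))) := by
  set f : ℂ → ℂ := fun z => compressionDet ((1 + S) + z • D) s with hf
  have hdiff : Differentiable ℂ f := differentiable_compressionDet _ _ _
  have hbound : ∀ z : ℂ, ‖z‖ ≤ 1 + 1 / r →
      ‖f z‖ ≤ Real.exp (2 * (singularSum S + (1 + r))) := fun z hz => by
    have h := norm_compressionDet_le (hS.add (hD.smul z)) s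
    rw [← add_assoc] at h
    refine h.trans (Real.exp_le_exp.2 ((singularSum_add_le hS (hD.smul z)).trans ?_))
    have h2 : ‖z‖ * singularSum D ≤ (1 + 1 / r) * r :=
      mul_le_mul hz hDr (singularSum_nonneg D) (by positivity)
    have h3 : (1 + 1 / r) * r = 1 + r := by field_simp; ring
    linarith [singularSum_smul_le hD z]
  have hderiv : ∀ z ∈ Metric.closedBall (0 : ℂ) 1,
      ‖deriv f z‖ ≤ r * Real.exp (2 * (singularSum S + (1 + r))) := fun z hz => by
    have h := Complex.norm_deriv_le_of_forall_mem_sphere_norm_le (c := z) (R := 1 / r)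
      (C := Real.exp (2 * (singularSum S + (1 + r)))) (f := f) (by positivity)
      hdiff.diffContOnCl (fun w hw => hbound w ?_)
    · rwa [div_div_eq_mul_div, div_one, mul_comm] at h
    · have h1 : ‖w - z‖ = 1 / r := by simpa using hw
      have h2 : ‖z‖ ≤ 1 := by simpa using hz
      calc ‖w‖ = ‖z + (w - z)‖ := by rw [add_sub_cancel]
        _ ≤ ‖z‖ + ‖w - z‖ := norm_add_le _ _
        _ ≤ _ := by rw [h1]; linarith
  have := (convex_closedBall (0 : ℂ) 1).norm_image_sub_le_of_norm_deriv_le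
    (fun z _ => hdiff z) hderiv (x := 0) (y := 1) (by simp) (by simp)
  simpa [hf, add_assoc] using this

theorem trace_compression (S : H →L[ℂ] H) (s : Finset (basisSet H)) :
    (compression s S).trace = ∑ i ∈ s, entry S i i := by
  rw [Matrix.trace, ← Finset.sum_coe_sort s]
  rfl

/-- The partial trace is the derivative at z = 0 of the compressed determinant of 1 + zS, which is
at most e on the circle of radius 1/r. -/
theorem norm_sum_entry_le {S : H →L[ℂ] H} (hS : IsTraceClass S) {r : ℝ} (hr : 0 < r)
    (hSr : singularSum S ≤ r) (s : Finset (basisSet H)) :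
    ‖∑ i ∈ s, entry S i i‖ ≤ r * Real.exp 1 := by
  classical
  set f : ℂ → ℂ := fun z => compressionDet (1 + z • S) s with hf
  have hone : compression s (1 : H →L[ℂ] H) = 1 := by
    ext i j
    rw [compression_apply, Matrix.one_apply]
    exact (orthonormal_iff_ite.1 (orthonormal_onb s)) i j
  have hd : HasDerivAt f (∑ i ∈ s, entry S i i) 0 := by
    rw [← trace_compression]
    simpa only [hf, compressionDet_eq, map_add, map_smul, hone] using
      hasDerivAt_det_one_add_smul (compression s S)
  have h := Complex.norm_deriv_le_of_forall_mem_sphere_norm_le (c := 0) (R := 1 / r)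
      (C := Real.exp 1) (f := f) (by positivity)
      (differentiable_compressionDet _ _ _).diffContOnCl (fun z hz => ?_)
  · rwa [hd.deriv, div_div_eq_mul_div, div_one, mul_comm] at h
  · refine (norm_compressionDet_le (hS.smul z) s).trans (Real.exp_le_exp.2 ?_)
    refine (singularSum_smul_le hS z).trans ?_
    have h1 : ‖z‖ = 1 / r := by simpa using hz
    rw [h1, one_div, inv_mul_le_iff₀ hr, mul_one]
    exact hSr

/-- The hypothesis is applied separately to the non-negative and the negative terms of a finite set.
-/
theorem summable_of_abs_sum_le {ι : Type*} {a : ι → ℝ} {C : ℝ}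
    (h : ∀ s : Finset ι, |∑ i ∈ s, a i| ≤ C) : Summable a := by
  classical
  refine Summable.of_abs (summable_of_sum_le (c := 2 * C) (fun i => abs_nonneg _) fun s => ?_)
  rw [← Finset.sum_filter_add_sum_filter_not s (fun i => 0 ≤ a i)]
  have h1 : ∑ i ∈ s with 0 ≤ a i, |a i| = ∑ i ∈ s with 0 ≤ a i, a i :=
    Finset.sum_congr rfl fun i hi => abs_of_nonneg (Finset.mem_filter.1 hi).2
  have h2 : ∑ i ∈ s with ¬ 0 ≤ a i, |a i| = -∑ i ∈ s with ¬ 0 ≤ a i, a i := by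
    rw [← Finset.sum_neg_distrib]
    exact Finset.sum_congr rfl fun i hi => abs_of_neg (not_le.1 (Finset.mem_filter.1 hi).2)
  rw [h1, h2]
  linarith [le_abs_self (∑ i ∈ s with 0 ≤ a i, a i), neg_abs_le (∑ i ∈ s with ¬ 0 ≤ a i, a i),
    h {i ∈ s | 0 ≤ a i}, h {i ∈ s | ¬ 0 ≤ a i}]

theorem summable_of_norm_sum_le {ι : Type*} {a : ι → ℂ} {C : ℝ}
    (h : ∀ s : Finset ι, ‖∑ i ∈ s, a i‖ ≤ C) : Summable a := by
  have hre : Summable fun i => (a i).re := summable_of_abs_sum_le fun s => by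
    rw [← Complex.re_sum]; exact (Complex.abs_re_le_norm _).trans (h s)
  have him : Summable fun i => (a i).im := summable_of_abs_sum_le fun s => by
    rw [← Complex.im_sum]; exact (Complex.abs_im_le_norm _).trans (h s)
  have := (Complex.ofRealCLM.summable hre).add ((Complex.ofRealCLM.summable him).mul_right Complex.I)
  simpa using this

theorem IsTraceClass.summable_entry {S : H →L[ℂ] H} (hS : IsTraceClass S) :
    Summable fun i => entry S i i :=
  summable_of_norm_sum_le fun s => norm_sum_entry_le hS
    (by linarith [singularSum_nonneg S] : 0 < singularSum S + 1) (by linarith) s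

end Estimates

/-! ### Coordinate projections and norm convergence of truncations. -/

section Projections

variable {H : Type*} [NormedAddCommGroup H] [InnerProductSpace ℂ H] [CompleteSpace H]

/-- The orthogonal projection onto the span of `{e_i | i ∈ s}`. -/
noncomputable def proj (s : Finset (basisSet H)) : H →L[ℂ] H :=
  ∑ i ∈ s, InnerProductSpace.rankOne ℂ (onb H i) (onb H i)

theorem proj_apply (s : Finset (basisSet H)) (x : H) :
    proj s x = ∑ i ∈ s, inner ℂ (onb H i) x • onb H i := by
  simp [proj]

theorem inner_onb (i j : basisSet H) [Decidable (i = j)] :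
    inner ℂ (onb H i) (onb H j) = if i = j then (1 : ℂ) else 0 := by
  classical
  convert! orthonormal_iff_ite.1 (onb H).orthonormal i j

open Classical in
theorem inner_proj (s : Finset (basisSet H)) (i : basisSet H) (x : H) :
    inner ℂ (onb H i) (proj s x) = if i ∈ s then inner ℂ (onb H i) x else 0 := by
  rw [proj_apply, inner_sum]
  simp [inner_smul_right, inner_onb]

open Classical in
theorem proj_onb (s : Finset (basisSet H)) (j : basisSet H) :
    proj s (onb H j) = if j ∈ s then onb H j else 0 := by
  rw [proj_apply]
  simp [inner_onb]

theorem proj_mul_self (s : Finset (basisSet H)) : proj s * proj s = proj s := by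
  ext x
  rw [mul_apply_eq_comp, proj_apply s (proj s x), proj_apply s x]
  refine Finset.sum_congr rfl fun i hi => ?_
  rw [← proj_apply, inner_proj, if_pos hi]

theorem norm_proj_le (s : Finset (basisSet H)) : ‖proj s‖ ≤ 1 := by
  refine ContinuousLinearMap.opNorm_le_bound _ zero_le_one fun x => ?_
  have h : proj s x = coordIncl s (WithLp.toLp 2 fun i : s => inner ℂ (onb H i) x) := by
    rw [proj_apply, ← Finset.sum_coe_sort s]
    rfl
  rw [one_mul, h, norm_coordIncl, ← sq_le_sq₀ (norm_nonneg _) (norm_nonneg _),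
    EuclideanSpace.norm_sq_eq]
  exact (orthonormal_onb s).sum_inner_products_le (s := Finset.univ) x

theorem tendsto_proj_apply (x : H) : Tendsto (fun s => proj s x) atTop (𝓝 x) := by
  simp_rw [proj_apply]
  have := (onb H).hasSum_repr x
  simp_rw [HilbertBasis.repr_apply_apply] at this
  exact this

/-- The compression `P_s A P_s` of `A`, as an operator on `H`. -/
noncomputable def trunc (s : Finset (basisSet H)) (A : H →L[ℂ] H) : H →L[ℂ] H :=
  proj s * A * proj s

theorem singularNumber_trunc_le (s : Finset (basisSet H)) (A : H →L[ℂ] H) (n : ℕ) :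
    singularNumber (trunc s A) n ≤ singularNumber A n := by
  have hA := singularNumber_nonneg A n
  refine (singularNumber_mul_le_mul_norm _ _ n).trans ?_
  refine (mul_le_of_le_one_right (singularNumber_nonneg _ _) (norm_proj_le s)).trans ?_
  exact (singularNumber_mul_le_norm_mul _ _ n).trans (mul_le_of_le_one_left hA (norm_proj_le s))

theorem norm_trunc_le (s : Finset (basisSet H)) (A : H →L[ℂ] H) : ‖trunc s A‖ ≤ ‖A‖ := by
  refine (norm_mul_le _ _).trans ((mul_le_of_le_one_right (norm_nonneg _) (norm_proj_le s)).trans ?_)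
  exact (norm_mul_le _ _).trans (mul_le_of_le_one_left (norm_nonneg _) (norm_proj_le s))

theorem IsSchatten.unif_trunc {k : ℕ} {A : H →L[ℂ] H} (hA : IsSchatten k A) :
    UnifSchatten k (fun s => trunc s A) :=
  ⟨singularNumber A, singularNumber_nonneg A, hA, fun s n => singularNumber_trunc_le s A n⟩

theorem tendsto_rankOne {ι : Type*} {l : Filter ι} {a b : ι → H} {a₀ b₀ : H}
    (ha : Tendsto a l (𝓝 a₀)) (hb : Tendsto b l (𝓝 b₀)) :
    Tendsto (fun i => InnerProductSpace.rankOne ℂ (a i) (b i)) l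
      (𝓝 (InnerProductSpace.rankOne ℂ a₀ b₀)) := by
  rw [tendsto_iff_norm_sub_tendsto_zero]
  have h : Tendsto (fun i => ‖a i - a₀‖ * ‖b i‖ + ‖a₀‖ * ‖b i - b₀‖) l (𝓝 0) := by
    simpa using ((ha.sub_const a₀).norm.mul hb.norm).add ((hb.sub_const b₀).norm.const_mul ‖a₀‖)
  refine squeeze_zero (fun i => norm_nonneg _) (fun i => ?_) h
  have : InnerProductSpace.rankOne ℂ (a i) (b i) - InnerProductSpace.rankOne ℂ a₀ b₀ =
      InnerProductSpace.rankOne ℂ (a i - a₀) (b i) +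
        InnerProductSpace.rankOne ℂ a₀ (b i - b₀) := by
    simp [map_sub]
  rw [this]
  refine (norm_add_le _ _).trans ?_
  rw [InnerProductSpace.norm_rankOne, InnerProductSpace.norm_rankOne]

/-- F is a finite sum of rank one operators, and truncation applies the projections to both vectors
of each; on vectors the projections converge strongly. -/
theorem tendsto_trunc_of_rank_le {F : H →L[ℂ] H} {n : ℕ}
    (hF : LinearMap.rank (F : H →ₗ[ℂ] H) ≤ (n : Cardinal)) :
    Tendsto (fun s => trunc s F) atTop (𝓝 F) := by
  have hfin : FiniteDimensional ℂ (LinearMap.range (F : H →ₗ[ℂ] H)) :=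
    Module.rank_lt_aleph0_iff.1 (hF.trans_lt Cardinal.natCast_lt_aleph0)
  set u := stdOrthonormalBasis ℂ (LinearMap.range (F : H →ₗ[ℂ] H))
  have hFsum : F = ∑ i, InnerProductSpace.rankOne ℂ (u i : H) (F.adjoint (u i)) := by
    ext x
    have := congrArg Subtype.val (u.sum_repr' ⟨F x, LinearMap.mem_range_self _ x⟩)
    simp only [Submodule.coe_sum, Submodule.coe_smul, Submodule.coe_inner] at this
    simp [ContinuousLinearMap.adjoint_inner_left, this]
  have hadj : ∀ s : Finset (basisSet H), (proj s).adjoint = proj s := fun s => by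
    simp [proj, map_sum]
  have htr : ∀ s, trunc s F = ∑ i, InnerProductSpace.rankOne ℂ (proj s (u i : H))
      (proj s (F.adjoint (u i))) := fun s => by
    conv_lhs => rw [hFsum]
    simp only [trunc, Finset.mul_sum, Finset.sum_mul]
    refine Finset.sum_congr rfl fun i _ => ?_
    rw [ContinuousLinearMap.mul_def, ContinuousLinearMap.mul_def, InnerProductSpace.comp_rankOne,
      InnerProductSpace.rankOne_comp, hadj]
  simp_rw [htr]
  conv => enter [3, 1]; rw [hFsum]
  refine tendsto_finsetSum _ fun i _ => ?_
  exact tendsto_rankOne (tendsto_proj_apply _) (tendsto_proj_apply _)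

/-- An ε/3 argument: the singular numbers tend to 0, so A lies within ε/3 of a finite rank operator,
and truncation does not increase norms. -/
theorem tendsto_trunc {k : ℕ} {A : H →L[ℂ] H} (hA : IsSchatten k A) :
    Tendsto (fun s => trunc s A) atTop (𝓝 A) := by
  rw [Metric.tendsto_nhds]
  intro ε hε
  have h0 : ∀ᶠ n in atTop, singularNumber A n ^ k < (ε / 3) ^ k :=
    hA.tendsto_atTop_zero.eventually (gt_mem_nhds (by positivity))
  obtain ⟨n, hn⟩ := h0.exists
  obtain ⟨F, hF, hF'⟩ := exists_norm_sub_lt A n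
    (lt_of_pow_lt_pow_left₀ k (by positivity) hn)
  filter_upwards [Metric.tendsto_nhds.1 (tendsto_trunc_of_rank_le hF) (ε / 3) (by positivity)]
    with s hs
  rw [dist_eq_norm] at hs ⊢
  have h1 : trunc s A - A = trunc s (A - F) + (trunc s F - F) - (A - F) := by
    simp only [trunc]; noncomm_ring
  rw [h1]
  have h2 := norm_trunc_le s (A - F)
  have h3 := norm_sub_le (trunc s (A - F) + (trunc s F - F)) (A - F)
  have h4 := norm_add_le (trunc s (A - F)) (trunc s F - F)
  linarith

end Projections

/-! ### Existence and continuity of Fredholm determinants and traces. -/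

section FredholmDet

variable {H : Type*} [NormedAddCommGroup H] [InnerProductSpace ℂ H] [CompleteSpace H]

/-- Relative to s and t \ s the matrix is block diagonal, with an identity block on t \ s. -/
theorem compressionDet_trunc (S : H →L[ℂ] H) {s t : Finset (basisSet H)} (hst : s ⊆ t) :
    compressionDet (1 + trunc s S) t = compressionDet (1 + S) s := by
  classical
  have hent : ∀ i j : basisSet H, entry (1 + trunc s S) i j = (if i = j then 1 else 0) +
      if i ∈ s ∧ j ∈ s then entry S i j else 0 := by
    intro i j
    rw [entry, add_apply, inner_add_right, one_apply_eq_self,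
      inner_onb, trunc, mul_apply_eq_comp, mul_apply_eq_comp, inner_proj,
      proj_onb, ite_and]
    by_cases hi : i ∈ s <;> by_cases hj : j ∈ s <;> simp [hi, hj, entry]
  rw [compressionDet, Matrix.twoBlockTriangular_det _ (fun i : t => (i : basisSet H) ∈ s)]
  · have h1 : Matrix.toSquareBlockProp (Matrix.of fun i j : t => entry (1 + trunc s S) i j)
        (fun i : t => ¬ (i : basisSet H) ∈ s) = 1 := by
      ext i j
      change entry (1 + trunc s S) (i : t) (j : t) = _
      rw [hent, Matrix.one_apply, if_neg (c := _ ∧ _) (fun h => i.2 h.1), add_zero]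
      exact if_congr ⟨fun h => Subtype.ext (Subtype.ext h), fun h => by rw [h]⟩ rfl rfl
    rw [h1, Matrix.det_one, mul_one, compressionDet]
    let e : s ≃ {i : t // (i : basisSet H) ∈ s} :=
      { toFun := fun i => ⟨⟨i, hst i.2⟩, i.2⟩
        invFun := fun i => ⟨i.1, i.2⟩
        left_inv := fun i => rfl
        right_inv := fun i => rfl }
    rw [← Matrix.det_submatrix_equiv_self e]
    congr 1
    ext i j
    change entry (1 + trunc s S) (i : basisSet H) (j : basisSet H) = _
    rw [hent, if_pos (c := _ ∧ _) ⟨i.2, j.2⟩, entry, Matrix.of_apply, entry, add_apply, inner_add_right,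
      one_apply_eq_self, inner_onb]
  · intro i hi j hj
    rw [Matrix.of_apply, hent, if_neg (c := _ ∧ _) (fun h => hi h.1), add_zero, if_neg]
    exact fun h => hi (h ▸ hj)

/-- For t ⊇ s the determinant over s equals the one over t with S replaced by `trunc s S`. The
Lipschitz estimate over t is uniform in t, so the net is Cauchy. -/
theorem tendsto_compressionDet {S : H →L[ℂ] H} (hS : IsTraceClass S) :
    Tendsto (compressionDet (1 + S)) atTop (𝓝 (fredholmDet (1 + S))) := by
  classical
  suffices h : CauchySeq (compressionDet (1 + S)) by
    obtain ⟨a, ha⟩ := cauchySeq_tendsto_of_complete h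
    exact tendsto_nhds_limUnder ⟨a, ha⟩
  rw [Metric.cauchySeq_iff']
  intro ε hε
  set C := Real.exp (2 * (singularSum S + (1 + 1)))
  have hC : 0 < C := Real.exp_pos _
  have hu : UnifSchatten 1 (fun s => trunc s S - S) :=
    (IsSchatten.unif_trunc hS).sub (IsSchatten.unif hS)
  have ht : Tendsto (fun s => trunc s S - S) atTop (𝓝 0) := by
    simpa using (tendsto_trunc hS).sub_const S
  have hpos : 0 < min 1 (ε / (2 * C)) := by positivity
  obtain ⟨s, hs⟩ := ((tendsto_singularSum hu ht).eventually (gt_mem_nhds hpos)).exists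
  have hexp : Real.exp (2 * (singularSum S + (1 + min 1 (ε / (2 * C))))) ≤ C :=
    Real.exp_le_exp.2 (by linarith [min_le_left 1 (ε / (2 * C))])
  refine ⟨s, fun t hst => ?_⟩
  rw [← compressionDet_trunc S hst, dist_comm, dist_eq_norm]
  have h := norm_compressionDet_sub_le hS (hu.isSchatten s) hpos hs.le t
  rw [add_sub_cancel] at h
  refine h.trans_lt ?_
  calc min 1 (ε / (2 * C)) * Real.exp (2 * (singularSum S + (1 + min 1 (ε / (2 * C)))))
      ≤ ε / (2 * C) * C := by
        gcongr
        exact min_le_right _ _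
    _ = ε / 2 := by field_simp
    _ < ε := by linarith

theorem tendsto_compressionDet_sub {S D : Finset (basisSet H) → H →L[ℂ] H}
    (hS : UnifSchatten 1 S) (hD : UnifSchatten 1 D) (h0 : Tendsto D atTop (𝓝 0)) :
    Tendsto (fun s => compressionDet (1 + (S s + D s)) s - compressionDet (1 + S s) s) atTop
      (𝓝 0) := by
  have hb : ∃ B, ∀ s, singularSum (S s) ≤ B := by
    have hS' := hS
    obtain ⟨b, hb0, hb, hSb⟩ := hS
    have hb' : Summable b := by simpa using hb
    exact ⟨∑' n, b n, fun s => (IsTraceClass.summable (hS'.isSchatten s)).tsum_le_tsum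
      (hSb s) hb'⟩
  obtain ⟨B, hB⟩ := hb
  rw [Metric.tendsto_nhds]
  intro ε hε
  set C := Real.exp (2 * (B + (1 + 1)))
  have hC : 0 < C := Real.exp_pos _
  have hpos : 0 < min 1 (ε / (2 * C)) := by positivity
  filter_upwards [(tendsto_singularSum hD h0).eventually (gt_mem_nhds hpos)] with s hs
  rw [dist_zero_right]
  have hexp : Real.exp (2 * (singularSum (S s) + (1 + min 1 (ε / (2 * C))))) ≤ C :=
    Real.exp_le_exp.2 (by linarith [min_le_left 1 (ε / (2 * C)), hB s])
  refine (norm_compressionDet_sub_le (hS.isSchatten s) (hD.isSchatten s) hpos hs.le s).trans_lt ?_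
  calc min 1 (ε / (2 * C)) * Real.exp (2 * (singularSum (S s) + (1 + min 1 (ε / (2 * C)))))
      ≤ ε / (2 * C) * C := by
        gcongr
        exact min_le_right _ _
    _ = ε / 2 := by field_simp
    _ < ε := by linarith

/-- Fredholm determinants may be computed from compressions of approximating operators. -/
theorem tendsto_compressionDet_of_tendsto {S : Finset (basisSet H) → H →L[ℂ] H} {S₀ : H →L[ℂ] H}
    (hS : UnifSchatten 1 S) (hS₀ : IsTraceClass S₀) (h : Tendsto S atTop (𝓝 S₀)) :
    Tendsto (fun s => compressionDet (1 + S s) s) atTop (𝓝 (fredholmDet (1 + S₀))) := by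
  have h1 := tendsto_compressionDet_sub (S := fun _ => S₀) (D := fun s => S s - S₀)
    (IsSchatten.unif hS₀) (hS.sub (IsSchatten.unif hS₀)) (by simpa using h.sub_const S₀)
  simpa using h1.add (tendsto_compressionDet hS₀)

/-- Traces may be computed from compressions of approximating operators. -/
theorem tendsto_sum_entry_of_tendsto {S : Finset (basisSet H) → H →L[ℂ] H} {S₀ : H →L[ℂ] H}
    (hS : UnifSchatten 1 S) (hS₀ : IsTraceClass S₀) (h : Tendsto S atTop (𝓝 S₀)) :
    Tendsto (fun s => ∑ i ∈ s, entry (S s) i i) atTop (𝓝 (trace S₀)) := by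
  have hu : UnifSchatten 1 (fun s => S s - S₀) := hS.sub (IsSchatten.unif hS₀)
  have h0 : Tendsto (fun s => ∑ i ∈ s, entry (S s - S₀) i i) atTop (𝓝 0) := by
    rw [Metric.tendsto_nhds]
    intro ε hε
    have hpos : 0 < ε / (2 * Real.exp 1) := by positivity
    filter_upwards [(tendsto_singularSum hu (by simpa using h.sub_const S₀)).eventually
      (gt_mem_nhds hpos)] with s hs
    rw [dist_zero_right]
    refine (norm_sum_entry_le (hu.isSchatten s) hpos hs.le s).trans_lt ?_
    have : ε / (2 * Real.exp 1) * Real.exp 1 = ε / 2 := by field_simp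
    linarith
  have h1 : Tendsto (fun s => ∑ i ∈ s, entry S₀ i i) atTop (𝓝 (trace S₀)) :=
    hS₀.summable_entry.hasSum
  have h2 := h0.add h1
  simp only [← Finset.sum_add_distrib, zero_add] at h2
  simpa [entry, inner_sub_right] using h2

end FredholmDet

/-! ### Truncated logarithm series. -/

section LogSum

variable {𝔸 : Type*} [Ring 𝔸] [Algebra ℂ 𝔸]

/-- The partial sums `∑_{1 ≤ j ≤ n} x ^ j / j` of `-log (1 - x)`. -/
noncomputable def logSum (n : ℕ) (x : 𝔸) : 𝔸 := ∑ j ∈ Finset.Icc 1 n, (1 / (j : ℂ)) • x ^ j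

theorem logSum_succ (n : ℕ) (x : 𝔸) :
    logSum (n + 1) x = logSum n x + (1 / ((n + 1 : ℕ) : ℂ)) • x ^ (n + 1) :=
  Finset.sum_Icc_succ_top (by omega) _

theorem commute_logSum {x y : 𝔸} (h : Commute x y) (n : ℕ) : Commute x (logSum n y) :=
  Commute.sum_right _ _ _ fun j _ => (h.pow_right j).smul_right _

theorem sub_smul_mul_sum_pow (x : 𝔸) (n : ℕ) (z : ℂ) :
    -x + (1 - z • x) * (∑ j ∈ Finset.range n, z ^ j • x ^ (j + 1)) = -(z ^ n • x ^ (n + 1)) := by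
  induction n with
  | zero => simp
  | succ n ih =>
    rw [Finset.sum_range_succ, mul_add, ← add_assoc, ih, sub_mul, one_mul, smul_mul_smul_comm,
      ← pow_succ', ← pow_succ']
    abel

end LogSum

/-! ### Factoring x^(n+1) out of the regularized factor minus 1. -/

section Exponential

variable {𝔸 : Type*} [NormedRing 𝔸] [NormedAlgebra ℂ 𝔸]

theorem continuous_logSum (n : ℕ) : Continuous (logSum n : 𝔸 → 𝔸) := by
  unfold logSum; fun_prop

theorem norm_logSum_le (n : ℕ) (x : 𝔸) : ‖logSum n x‖ ≤ ∑ j ∈ Finset.Icc 1 n, ‖x‖ ^ j := by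
  refine (norm_sum_le _ _).trans (Finset.sum_le_sum fun j hj => ?_)
  have hj1 := (Finset.mem_Icc.1 hj).1
  refine (norm_smul_le _ _).trans ?_
  have : ‖(1 / (j : ℂ))‖ ≤ 1 := by
    rw [norm_div, norm_one, Complex.norm_natCast]
    exact div_le_one_of_le₀ (by exact_mod_cast hj1) (by positivity)
  exact (mul_le_of_le_one_left (norm_nonneg _) this).trans (norm_pow_le' x hj1)

variable [CompleteSpace 𝔸]

theorem continuous_normedSpace_exp : Continuous (NormedSpace.exp : 𝔸 → 𝔸) :=
  letI : NormedAlgebra ℚ 𝔸 := NormedAlgebra.restrictScalars ℚ ℂ 𝔸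
  NormedSpace.exp_continuous

theorem normedSpace_exp_add {x y : 𝔸} (h : Commute x y) :
    NormedSpace.exp (x + y) = NormedSpace.exp x * NormedSpace.exp y :=
  letI : NormedAlgebra ℚ 𝔸 := NormedAlgebra.restrictScalars ℚ ℂ 𝔸
  NormedSpace.exp_add_of_commute h

theorem norm_normedSpace_exp_le (h1 : ‖(1 : 𝔸)‖ ≤ 1) (x : 𝔸) :
    ‖NormedSpace.exp x‖ ≤ Real.exp ‖x‖ := by
  have hr := NormedSpace.exp_series_hasSum_exp' (𝕂 := ℝ) ‖x‖
  rw [← Real.exp_eq_exp_ℝ] at hr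
  refine (NormedSpace.exp_series_hasSum_exp' (𝕂 := ℂ) x).norm_le_of_bounded hr fun n => ?_
  rw [norm_smul, norm_inv, Complex.norm_natCast, smul_eq_mul]
  refine mul_le_mul_of_nonneg_left ?_ (by positivity)
  rcases n.eq_zero_or_pos with rfl | hn
  · simpa using h1
  · exact norm_pow_le' x hn

/-- The summands of `logSum` are powers of x and commute, so the top one splits off the exponential
and induction applies. -/
theorem hasDerivAt_exp_logSum (x : 𝔸) (n : ℕ) (z : ℂ) :
    HasDerivAt (fun z : ℂ => NormedSpace.exp (logSum n (z • x)))
      ((∑ j ∈ Finset.range n, z ^ j • x ^ (j + 1)) * NormedSpace.exp (logSum n (z • x))) z := by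
  induction n with
  | zero => simpa [logSum] using hasDerivAt_const z (1 : 𝔸)
  | succ n ih =>
    have hc : ∀ w : ℂ, Commute (x ^ (n + 1)) (logSum n (w • x)) := fun w =>
      commute_logSum (((Commute.refl x).pow_left _).smul_right w) n
    have hexp : ∀ w : ℂ, NormedSpace.exp (logSum (n + 1) (w • x)) =
        NormedSpace.exp (logSum n (w • x)) *
          NormedSpace.exp ((w ^ (n + 1) / ((n + 1 : ℕ) : ℂ)) • x ^ (n + 1)) := fun w => by
      have : logSum (n + 1) (w • x) =
          logSum n (w • x) + (w ^ (n + 1) / ((n + 1 : ℕ) : ℂ)) • x ^ (n + 1) := by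
        rw [logSum_succ, smul_pow, smul_smul]
        congr 2
        ring
      rw [this, normedSpace_exp_add ((hc w).symm.smul_right _)]
    have hpow : HasDerivAt (fun w : ℂ => w ^ (n + 1) / ((n + 1 : ℕ) : ℂ)) (z ^ n) z := by
      have h0 : ((n + 1 : ℕ) : ℂ) ≠ 0 := by exact_mod_cast n.succ_ne_zero
      have := (hasDerivAt_pow (n + 1) z).div_const ((n + 1 : ℕ) : ℂ)
      rwa [mul_comm, Nat.add_sub_cancel, mul_div_assoc, div_self h0, mul_one] at this
    have h2 := (hasDerivAt_exp_smul_const' (x ^ (n + 1))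
      (z ^ (n + 1) / ((n + 1 : ℕ) : ℂ))).scomp z hpow
    have h3 := ih.mul h2
    simp only [hexp]
    convert! h3 using 1
    rw [Finset.sum_range_succ, add_mul, mul_assoc]
    congr 1
    simp only [smul_mul_assoc, mul_smul_comm]
    rw [← mul_assoc, ← mul_assoc, ((hc z).exp_right).eq]

/-- In the product rule the geometric sum telescopes against 1 - zx, leaving only the top power
x^(n+1). -/
theorem hasDerivAt_one_sub_mul_exp_logSum (x : 𝔸) (n : ℕ) (z : ℂ) :
    HasDerivAt (fun z : ℂ => (1 - z • x) * NormedSpace.exp (logSum n (z • x)))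
      (x ^ (n + 1) * (-(z ^ n • NormedSpace.exp (logSum n (z • x))))) z := by
  have h1 : HasDerivAt (fun z : ℂ => 1 - z • x) (-x) z := by
    simpa using ((hasDerivAt_id z).smul_const x).const_sub 1
  convert! h1.mul (hasDerivAt_exp_logSum x n z) using 1
  rw [← mul_assoc, ← add_mul, sub_smul_mul_sum_pow]
  simp

/-- Integrating the derivative along [0, 1] and pulling the constant left factor x^(n+1) out of the
integral. -/
theorem one_sub_mul_exp_logSum (x : 𝔸) (n : ℕ) :
    (1 - x) * NormedSpace.exp (logSum n x) - 1 = x ^ (n + 1) *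
      ∫ t in (0 : ℝ)..1, (-((t : ℂ) ^ n • NormedSpace.exp (logSum n ((t : ℂ) • x)))) := by
  have hcont : Continuous fun t : ℝ =>
      (-((t : ℂ) ^ n • NormedSpace.exp (logSum n ((t : ℂ) • x)))) := by
    have h := (continuous_normedSpace_exp (𝔸 := 𝔸)).comp (continuous_logSum n)
    have h2 : Continuous fun t : ℝ => ((t : ℂ) • x) := by fun_prop
    have h3 := h.comp h2
    have h4 : Continuous fun t : ℝ => (t : ℂ) ^ n := by fun_prop
    exact (h4.smul h3).neg
  have hcont' : Continuous fun t : ℝ => x ^ (n + 1) *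
      (-((t : ℂ) ^ n • NormedSpace.exp (logSum n ((t : ℂ) • x)))) := continuous_const.mul hcont
  have hderiv : ∀ t : ℝ, HasDerivAt
      (fun t : ℝ => (1 - (t : ℂ) • x) * NormedSpace.exp (logSum n ((t : ℂ) • x)))
      (x ^ (n + 1) * (-((t : ℂ) ^ n • NormedSpace.exp (logSum n ((t : ℂ) • x))))) t := fun t => by
    have := (hasDerivAt_one_sub_mul_exp_logSum x n (t : ℂ)).scomp t
      (Complex.ofRealCLM.hasDerivAt (x := t))
    simpa [Function.comp_def] using this
  have h := intervalIntegral.integral_eq_sub_of_hasDerivAt (a := 0) (b := 1)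
    (fun t _ => hderiv t) (hcont'.intervalIntegrable _ _)
  have h2 := (ContinuousLinearMap.mul ℝ 𝔸 (x ^ (n + 1))).intervalIntegral_comp_comm
    (hcont.intervalIntegrable (μ := MeasureTheory.volume) 0 1)
  simp only [ContinuousLinearMap.mul_apply'] at h2
  rw [← h2, h]
  simp [logSum, zero_pow_eq]

theorem exists_pow_mul_eq (h1 : ‖(1 : 𝔸)‖ ≤ 1) (n : ℕ) (r : ℝ) :
    ∃ C : ℝ, 0 ≤ C ∧ ∀ x : 𝔸, ‖x‖ ≤ r → ∃ G : 𝔸,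
      (1 - x) * NormedSpace.exp (logSum n x) - 1 = x ^ (n + 1) * G ∧ ‖G‖ ≤ C := by
  refine ⟨Real.exp (∑ j ∈ Finset.Icc 1 n, r ^ j), by positivity, fun x hx =>
    ⟨_, one_sub_mul_exp_logSum x n, ?_⟩⟩
  have h := intervalIntegral.norm_integral_le_of_norm_le_const (a := 0) (b := 1)
    (f := fun t : ℝ => (-((t : ℂ) ^ n • NormedSpace.exp (logSum n ((t : ℂ) • x)))))
    (C := Real.exp (∑ j ∈ Finset.Icc 1 n, r ^ j)) fun t ht => ?_
  · simpa using h
  · rw [Set.uIoc_of_le zero_le_one] at ht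
    have ht1 : ‖(t : ℂ)‖ ≤ 1 := by
      rw [Complex.norm_real, Real.norm_of_nonneg ht.1.le]; exact ht.2
    rw [norm_neg]
    refine (norm_smul_le _ _).trans ?_
    rw [norm_pow]
    refine (mul_le_of_le_one_left (norm_nonneg _) (pow_le_one₀ (norm_nonneg _) ht1)).trans ?_
    refine (norm_normedSpace_exp_le h1 _).trans (Real.exp_le_exp.2 ((norm_logSum_le _ _).trans ?_))
    gcongr
    exact (norm_smul_le _ _).trans ((mul_le_of_le_one_left (norm_nonneg _) ht1).trans hx)

end Exponential

/-! ### Trace class property and continuity of the regularized determinant. -/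

section Regularize

variable {H : Type*} [NormedAddCommGroup H] [InnerProductSpace ℂ H] [CompleteSpace H]

theorem regularize_one_sub (k : ℕ) (A : H →L[ℂ] H) :
    regularize k (1 - A) = (1 - A) * NormedSpace.exp (logSum (k - 1) A) := by
  rw [regularize, sub_sub_cancel]; rfl

theorem continuous_regularize (k : ℕ) : Continuous fun A : H →L[ℂ] H => regularize k (1 - A) := by
  simp_rw [regularize_one_sub]
  exact (continuous_const.sub continuous_id).mul
    (continuous_normedSpace_exp.comp (continuous_logSum _))

theorem exists_regularize_eq {k : ℕ} (hk : 1 ≤ k) (r : ℝ) :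
    ∃ C : ℝ, 0 ≤ C ∧ ∀ A : H →L[ℂ] H, ‖A‖ ≤ r → ∃ G : H →L[ℂ] H,
      regularize k (1 - A) - 1 = A ^ k * G ∧ ‖G‖ ≤ C := by
  simpa only [regularize_one_sub, Nat.sub_add_cancel hk] using
    exists_pow_mul_eq (𝔸 := H →L[ℂ] H) norm_one_clm_le (k - 1) r

theorem UnifSchatten.regularize {ι : Type*} {k : ℕ} (hk : 1 ≤ k) {X : ι → H →L[ℂ] H}
    (hX : UnifSchatten k X) : UnifSchatten 1 (fun i => regularize k (1 - X i) - 1) := by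
  -- The value at 0 of the common majorant bounds all operator norms, so a single constant C serves
  -- the whole family.
  obtain ⟨C, hC, hG⟩ := exists_regularize_eq (H := H) hk (hX.choose 0)
  choose G hG hGC using fun i => hG (X i)
    ((norm_le_singularNumber_zero _).trans (hX.choose_spec.2.2 i 0))
  simp only [hG]
  exact (hX.pow hk).mul_bounded hGC hC

theorem tendsto_detk {k : ℕ} (hk : 1 ≤ k) {X : Finset (basisSet H) → H →L[ℂ] H} {X₀ : H →L[ℂ] H}
    (hX : UnifSchatten k X) (hX₀ : IsSchatten k X₀) (h : Tendsto X atTop (𝓝 X₀)) :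
    Tendsto (fun s => compressionDet (regularize k (1 - X s)) s) atTop (𝓝 (detk k (1 - X₀))) := by
  have h1 := tendsto_compressionDet_of_tendsto (hX.regularize hk)
    ((IsSchatten.unif (ι := Unit) hX₀).regularize hk |>.isSchatten ())
    ((((continuous_regularize k).tendsto X₀).comp h).sub_const 1)
  simpa [detk] using h1

end Regularize

/-! ### Compression as a homomorphism on operators commuting with the projection. -/

section CompressionAlgebra

variable {H : Type*} [NormedAddCommGroup H] [InnerProductSpace ℂ H] [CompleteSpace H]
  {s : Finset (basisSet H)}

theorem commute_proj_trunc (s : Finset (basisSet H)) (A : H →L[ℂ] H) :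
    Commute (proj s) (trunc s A) := by
  rw [Commute, SemiconjBy, trunc, ← mul_assoc, ← mul_assoc, proj_mul_self, mul_assoc _ (proj s),
    proj_mul_self]

open Classical in
theorem compression_one : compression s (1 : H →L[ℂ] H) = 1 := by
  classical
  ext i j
  rw [compression_apply, Matrix.one_apply]
  exact (orthonormal_iff_ite.1 (orthonormal_onb s)) i j

/-- Only Y has to preserve the coordinate subspace; X is arbitrary, since what it maps outside the
subspace is discarded by the final inner product. -/
theorem compression_mul (X : H →L[ℂ] H) {Y : H →L[ℂ] H} (hY : Commute (proj s) Y) :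
    compression s (X * Y) = compression s X * compression s Y := by
  classical
  ext i j
  have h : Y (onb H j) = ∑ k : s, compression s Y k j • onb H k := by
    have h1 : Y (onb H j) = proj s (Y (onb H j)) := by
      have := congrArg (fun T : H →L[ℂ] H => T (onb H j)) hY.eq
      simp only [mul_apply_eq_comp, proj_onb, if_pos j.2] at this
      exact this.symm
    rw [h1, proj_apply, ← Finset.sum_coe_sort s]
    rfl
  rw [Matrix.mul_apply, compression_apply, mul_apply_eq_comp, h, map_sum, inner_sum]
  refine Finset.sum_congr rfl fun k _ => ?_
  rw [map_smul, inner_smul_right, mul_comm]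
  rfl

theorem compressionDet_mul (X : H →L[ℂ] H) {Y : H →L[ℂ] H} (hY : Commute (proj s) Y) :
    compressionDet (X * Y) s = compressionDet X s * compressionDet Y s := by
  classical
  rw [compressionDet_eq, compression_mul X hY, Matrix.det_mul]
  rfl

theorem commute_proj_eval {A B : H →L[ℂ] H} (hA : Commute (proj s) A) (hB : Commute (proj s) B)
    (Q : NCPoly) : Commute (proj s) (eval A B Q) := by
  induction Q using FreeAlgebra.induction with
  | grade0 r =>
    rw [eval, AlgHom.commutes]
    exact (Algebra.commutes r _).symm
  | grade1 i => fin_cases i <;> simpa [eval]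
  | mul p q hp hq => simpa [eval] using hp.mul_right hq
  | add p q hp hq => simpa [eval] using hp.add_right hq

open Classical in
theorem compression_eval {A B : H →L[ℂ] H} (hA : Commute (proj s) A) (hB : Commute (proj s) B)
    (Q : NCPoly) :
    compression s (eval A B Q) = FreeAlgebra.lift ℂ ![compression s A, compression s B] Q := by
  classical
  induction Q using FreeAlgebra.induction with
  | grade0 r =>
    rw [eval, AlgHom.commutes, AlgHom.commutes, Algebra.algebraMap_eq_smul_one, map_smul,
      compression_one, Algebra.algebraMap_eq_smul_one]
  | grade1 i => fin_cases i <;> simp [eval]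
  | mul p q hp hq =>
    rw [map_mul, ← hp, ← hq, ← compression_mul _ (commute_proj_eval hA hB q)]
    simp [eval]
  | add p q hp hq =>
    rw [map_add, ← hp, ← hq, ← map_add]
    simp [eval]

theorem hasDerivAt_det_of_eq_one {ι : Type*} [Fintype ι] [DecidableEq ι] {M : ℂ → Matrix ι ι ℂ}
    {M' : Matrix ι ι ℂ} (h : ∀ i j, HasDerivAt (fun z => M z i j) (M' i j) 0) (h1 : M 0 = 1) :
    HasDerivAt (fun z => (M z).det) M'.trace 0 := by
  have key : ∀ N : ℂ → Matrix ι ι ℂ, (∀ i j, HasDerivAt (fun z => N z i j) (M' i j) 0) →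
      N 0 = 1 → HasDerivAt (fun z => (N z).det)
        (∑ σ : Equiv.Perm ι, Equiv.Perm.sign σ • ∑ i,
          (∏ j ∈ Finset.univ.erase i, (1 : Matrix ι ι ℂ) (σ j) j) • M' (σ i) i) 0 := by
    intro N hN h1
    simp only [Matrix.det_apply]
    refine HasDerivAt.fun_sum fun σ _ => HasDerivAt.const_smul _ ?_
    have := HasDerivAt.fun_finsetProd (u := Finset.univ) (x := (0 : ℂ))
      (f := fun i z => N z (σ i) i) (f' := fun i => M' (σ i) i) fun i _ => hN _ _
    simpa only [h1] using this
  have h2 := key (fun z => 1 + z • M') (fun i j => by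
    simpa using ((hasDerivAt_id (0 : ℂ)).mul_const (M' i j)).const_add ((1 : Matrix ι ι ℂ) i j))
    (by simp)
  rw [(hasDerivAt_det_one_add_smul M').unique h2]
  exact key M h h1

/-- z ↦ det exp(zY) turns sums into products and has derivative τ = tr Y at 0. It therefore solves
f' = τ f, and f(z) exp(-zτ) is constant. -/
theorem compressionDet_exp {Y : H →L[ℂ] H} (hY : Commute (proj s) Y) :
    compressionDet (NormedSpace.exp Y) s = Complex.exp (compression s Y).trace := by
  classical
  set τ := (compression s Y).trace with hτ
  set f : ℂ → ℂ := fun z => compressionDet (NormedSpace.exp (z • Y)) s with hf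
  have hf0 : HasDerivAt f τ 0 := by
    refine hasDerivAt_det_of_eq_one (M := fun z => compression s (NormedSpace.exp (z • Y)))
      (fun i j => ?_) ?_
    · have h := hasDerivAt_exp_smul_const' Y (0 : ℂ)
      rw [zero_smul, NormedSpace.exp_zero, mul_one] at h
      exact ((innerSL ℂ (onb H (i : basisSet H))).comp
        (ContinuousLinearMap.apply ℂ H (onb H (j : basisSet H)))).hasFDerivAt.comp_hasDerivAt 0 h
    · simp only [zero_smul, NormedSpace.exp_zero, compression_one]
  have hadd : ∀ z w, f (z + w) = f z * f w := fun z w => by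
    simp only [hf]
    rw [add_smul, normedSpace_exp_add (((Commute.refl Y).smul_left z).smul_right w),
      compressionDet_mul _ (hY.smul_right w).exp_right]
  have hderiv : ∀ z, HasDerivAt f (f z * τ) z := fun z => by
    have h1 : HasDerivAt (fun w => f z * f (w - z)) (f z * τ) z := by
      refine HasDerivAt.const_mul _ ?_
      have := HasDerivAt.comp_sub_const (f := f) (f' := τ) z z (by simpa using hf0)
      exact this
    refine h1.congr_of_eventuallyEq (Eventually.of_forall fun w => ?_)
    change f w = f z * f (w - z)
    rw [← hadd, add_sub_cancel]
  have hg : ∀ z, HasDerivAt (fun z => f z * Complex.exp (-(z * τ))) 0 z := fun z => by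
    have h2 : HasDerivAt (fun z : ℂ => Complex.exp (-(z * τ))) (Complex.exp (-(z * τ)) * -τ) z := by
      have := ((hasDerivAt_id z).mul_const τ).neg.cexp
      simpa using this
    convert! (hderiv z).mul h2 using 1
    ring
  have hconst := is_const_of_deriv_eq_zero (fun z => (hg z).differentiableAt)
    (fun z => (hg z).deriv) 1 0
  have hfz : f 0 = 1 := by
    simp only [hf]
    rw [zero_smul, NormedSpace.exp_zero, compressionDet_eq, compression_one, Matrix.det_one]
  simp only [one_mul, zero_mul, neg_zero, Complex.exp_zero, hfz, mul_one] at hconst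
  have : f 1 = compressionDet (NormedSpace.exp Y) s := by simp [hf]
  calc compressionDet (NormedSpace.exp Y) s = f 1 * Complex.exp (-τ) * Complex.exp τ := by
        rw [mul_assoc, ← Complex.exp_add, neg_add_cancel, Complex.exp_zero, mul_one, this]
    _ = Complex.exp τ := by rw [hconst, one_mul]

theorem compressionDet_regularize (k : ℕ) {A : H →L[ℂ] H} (hA : Commute (proj s) A) :
    compressionDet (regularize k (1 - A)) s = compressionDet (1 - A) s *
      Complex.exp (compression s (logSum (k - 1) A)).trace := by
  rw [regularize_one_sub, compressionDet_mul _ (commute_logSum hA _).exp_right,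
    compressionDet_exp (commute_logSum hA _)]

theorem compressionDet_regularize_mul (k : ℕ) {A B : H →L[ℂ] H} (hA : Commute (proj s) A)
    (hB : Commute (proj s) B) :
    compressionDet (regularize k (1 - (A + B - A * B))) s =
      compressionDet (regularize k (1 - A)) s * compressionDet (regularize k (1 - B)) s *
        Complex.exp (compression s
          (logSum (k - 1) (A + B - A * B) - logSum (k - 1) A - logSum (k - 1) B)).trace := by
  have h1 : 1 - (A + B - A * B) = (1 - A) * (1 - B) := by noncomm_ring
  rw [compressionDet_regularize k ((hA.add_right hB).sub_right (hA.mul_right hB)), h1,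
    compressionDet_mul _ ((Commute.one_right _).sub_right hB), compressionDet_regularize k hA,
    compressionDet_regularize k hB]
  simp only [map_sub, Matrix.trace_sub, Complex.exp_sub]
  field_simp [Complex.exp_ne_zero]

end CompressionAlgebra

/-! ### Regularized determinants are 1 + O(z^k) for small z. -/

section SmallParameter

open Asymptotics

/-- For |w| < 1/2, |exp w - 1 - w| ≤ |w|² ≤ |w|/2, hence |w| ≤ 2 |exp w - 1|. -/
theorem isBigO_of_exp_sub_one {α : Type*} {l : Filter α} {p : α → ℂ} {g : α → ℂ}
    (hp : Tendsto p l (𝓝 0)) (h : (fun z => Complex.exp (p z) - 1) =O[l] g) : p =O[l] g := by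
  refine IsBigO.trans (IsBigO.of_bound 2 ?_) h
  have h1 : ∀ᶠ z in l, ‖p z‖ < 1 / 2 := by
    simpa using hp.norm.eventually (gt_mem_nhds (by simp : ‖(0 : ℂ)‖ < 1 / 2))
  filter_upwards [h1] with z hz
  have h2 := Complex.norm_exp_sub_one_sub_id_le (x := p z) (by linarith)
  have h3 : ‖p z‖ ≤ ‖Complex.exp (p z) - 1‖ + ‖Complex.exp (p z) - 1 - p z‖ := by
    have := norm_sub_le (Complex.exp (p z) - 1) (Complex.exp (p z) - 1 - p z)
    rwa [sub_sub_cancel] at this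
  nlinarith [norm_nonneg (p z)]

theorem X_pow_dvd_of_isBigO {p : Polynomial ℂ} {k : ℕ}
    (h : (fun z => p.eval z) =O[𝓝[≠] 0] fun z : ℂ => z ^ k) : Polynomial.X ^ k ∣ p := by
  suffices H : ∀ m ≤ k, (Polynomial.X : Polynomial ℂ) ^ m ∣ p from H k le_rfl
  intro m
  induction m with
  | zero => simp
  | succ m ih =>
    intro hm
    obtain ⟨q, rfl⟩ := ih (by omega)
    rw [pow_succ]
    refine mul_dvd_mul_left _ (Polynomial.X_dvd_iff.2 ?_)
    rw [Polynomial.coeff_zero_eq_eval_zero]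
    have h1 : (fun z => q.eval z) =O[𝓝[≠] 0] fun z : ℂ => z ^ (k - m) := by
      obtain ⟨c, hc⟩ := h.bound
      refine IsBigO.of_bound c ?_
      filter_upwards [hc, self_mem_nhdsWithin] with z hz hz0
      rw [Polynomial.eval_mul, Polynomial.eval_pow, Polynomial.eval_X, norm_mul,
        ← Nat.add_sub_cancel' (by omega : m ≤ k), pow_add, norm_mul, mul_left_comm] at hz
      have : 0 < ‖z ^ m‖ := norm_pos_iff.2 (pow_ne_zero _ hz0)
      exact le_of_mul_le_mul_left hz this
    have h2 : Tendsto (fun z : ℂ => z ^ (k - m)) (𝓝[≠] 0) (𝓝 0) := by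
      have : Tendsto (fun z : ℂ => z ^ (k - m)) (𝓝 0) (𝓝 (0 ^ (k - m))) :=
        (continuous_pow (k - m)).tendsto 0
      rw [zero_pow (by omega)] at this
      exact this.mono_left nhdsWithin_le_nhds
    exact tendsto_nhds_unique ((q.continuous.tendsto 0).mono_left nhdsWithin_le_nhds)
      (h1.trans_tendsto h2)

theorem coeff_eq_zero_of_exp_eval_isBigO {p : Polynomial ℂ} {k : ℕ} (hp : p.eval 0 = 0)
    (h : (fun z => Complex.exp (p.eval z) - 1) =O[𝓝[≠] 0] fun z : ℂ => z ^ k) {m : ℕ}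
    (hm : m < k) : p.coeff m = 0 := by
  refine (Polynomial.X_pow_dvd_iff.1 (X_pow_dvd_of_isBigO (isBigO_of_exp_sub_one ?_ h))) m hm
  have := (p.continuous.tendsto 0).mono_left (nhdsWithin_le_nhds (s := {0}ᶜ))
  rwa [hp] at this

variable {H : Type*} [NormedAddCommGroup H] [InnerProductSpace ℂ H] [CompleteSpace H]

/-- The regularized operator minus 1 is z^k W^k G with W^k G uniformly trace class; the Lipschitz
estimate at S = 0 gives the bound. W may depend on z so that the product (1 - zA)(1 - zB), with W =
A + B - zAB, is covered. -/
theorem exists_norm_compressionDet_regularize_sub_one_le {k : ℕ} (hk : 1 ≤ k)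
    {W : Metric.closedBall (0 : ℂ) 1 → H →L[ℂ] H} (hW : UnifSchatten k W) :
    ∃ C : ℝ, ∀ (z : Metric.closedBall (0 : ℂ) 1) (s : Finset (basisSet H)), (z : ℂ) ≠ 0 →
      ‖compressionDet (regularize k (1 - (z : ℂ) • W z)) s - 1‖ ≤ C * ‖(z : ℂ) ^ k‖ := by
  have hz1 : ∀ z : Metric.closedBall (0 : ℂ) 1, ‖(z : ℂ)‖ ≤ 1 := fun z =>
    mem_closedBall_zero_iff.1 z.2
  obtain ⟨C, hC, hG⟩ := exists_regularize_eq (H := H) hk (hW.choose 0)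
  choose G hG hGC using fun z : Metric.closedBall (0 : ℂ) 1 => hG ((z : ℂ) • W z)
    ((norm_smul_le _ _).trans ((mul_le_of_le_one_left (norm_nonneg _) (hz1 z)).trans
      ((norm_le_singularNumber_zero _).trans (hW.choose_spec.2.2 z 0))))
  have hu := (hW.pow hk).mul_bounded hGC hC
  obtain ⟨b, hb0, hb, hub⟩ := id hu
  have hb' : Summable b := by simpa using hb
  set B := ∑' n, b n with hB
  have hB0 : 0 ≤ B := tsum_nonneg hb0
  have hsum : ∀ z, singularSum (W z ^ k * G z) ≤ B := fun z =>
    (IsTraceClass.summable (hu.isSchatten z)).tsum_le_tsum (hub z) hb'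
  refine ⟨(B + 1) * Real.exp (2 * (singularSum (0 : H →L[ℂ] H) + (1 + (B + 1)))),
    fun z s hz => ?_⟩
  have hzk : ‖(z : ℂ) ^ k‖ ≤ 1 := by rw [norm_pow]; exact pow_le_one₀ (norm_nonneg _) (hz1 z)
  have hzpos : 0 < ‖(z : ℂ) ^ k‖ := norm_pos_iff.2 (pow_ne_zero _ hz)
  have h := norm_compressionDet_sub_le (S := 0) (D := (z : ℂ) ^ k • (W z ^ k * G z))
    (r := (B + 1) * ‖(z : ℂ) ^ k‖) ((UnifSchatten.zero (ι := Unit) le_rfl).isSchatten ())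
    (IsTraceClass.smul (hu.isSchatten z) _) (by positivity) ?_ s
  · have h1 : (1 : H →L[ℂ] H) + (0 + (z : ℂ) ^ k • (W z ^ k * G z)) =
        regularize k (1 - (z : ℂ) • W z) := by
      rw [zero_add, ← smul_mul_assoc, ← smul_pow, ← hG z, add_sub_cancel]
    have h2 : compressionDet (1 + (0 : H →L[ℂ] H)) s = 1 := by
      classical
      rw [add_zero, compressionDet_eq, compression_one, Matrix.det_one]
    rw [h1, h2] at h
    refine h.trans ?_
    rw [mul_right_comm]
    gcongr
    exact mul_le_of_le_one_right (by positivity) hzk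
  · refine (singularSum_smul_le (hu.isSchatten z) _).trans ?_
    rw [mul_comm]
    gcongr
    linarith [hsum z]

end SmallParameter

/-! ### Degrees in the generating polynomial. -/

section Homogeneity

theorem word_append (l l' : List (Fin 2)) : word (l ++ l') = word l * word l' := by
  simp [word]

theorem IsHomogeneousOfDegree.mul {m n : ℕ} {p q : NCPoly} (hp : IsHomogeneousOfDegree m p)
    (hq : IsHomogeneousOfDegree n q) : IsHomogeneousOfDegree (m + n) (p * q) := by
  have h := Submodule.mul_mem_mul hp hq
  rw [Submodule.span_mul_span] at h
  refine Submodule.span_mono ?_ h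
  rintro _ ⟨_, ⟨l, rfl, rfl⟩, _, ⟨l', rfl, rfl⟩, rfl⟩
  exact ⟨l ++ l', List.length_append, (word_append l l').symm⟩

theorem isHomogeneousOfDegree_word (l : List (Fin 2)) : IsHomogeneousOfDegree l.length (word l) :=
  Submodule.subset_span ⟨l, rfl, rfl⟩

/-- The coefficient of `t ^ m` is homogeneous of degree `m`. -/
def CoeffHomogeneous (f : Polynomial NCPoly) : Prop := ∀ m, IsHomogeneousOfDegree m (f.coeff m)

theorem CoeffHomogeneous.add {f g : Polynomial NCPoly} (hf : CoeffHomogeneous f)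
    (hg : CoeffHomogeneous g) : CoeffHomogeneous (f + g) := fun m => by
  rw [Polynomial.coeff_add]; exact Submodule.add_mem _ (hf m) (hg m)

theorem CoeffHomogeneous.sub {f g : Polynomial NCPoly} (hf : CoeffHomogeneous f)
    (hg : CoeffHomogeneous g) : CoeffHomogeneous (f - g) := fun m => by
  rw [Polynomial.coeff_sub]; exact Submodule.sub_mem _ (hf m) (hg m)

theorem CoeffHomogeneous.smul {f : Polynomial NCPoly} (hf : CoeffHomogeneous f) (c : ℂ) :
    CoeffHomogeneous (c • f) := fun m => by
  rw [Polynomial.coeff_smul]; exact Submodule.smul_mem _ c (hf m)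

theorem CoeffHomogeneous.mul {f g : Polynomial NCPoly} (hf : CoeffHomogeneous f)
    (hg : CoeffHomogeneous g) : CoeffHomogeneous (f * g) := fun m => by
  rw [Polynomial.coeff_mul]
  refine Submodule.sum_mem _ fun x hx => ?_
  rw [← Finset.HasAntidiagonal.mem_antidiagonal.1 hx]
  exact (hf _).mul (hg _)

theorem coeffHomogeneous_C_mul_X_pow {n : ℕ} {p : NCPoly} (hp : IsHomogeneousOfDegree n p) :
    CoeffHomogeneous (Polynomial.C p * Polynomial.X ^ n) := fun m => by
  rw [Polynomial.coeff_C_mul_X_pow]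
  split_ifs with h
  · exact h ▸ hp
  · exact Submodule.zero_mem _

theorem CoeffHomogeneous.pow {f : Polynomial NCPoly} (hf : CoeffHomogeneous f) (n : ℕ) :
    CoeffHomogeneous (f ^ n) := by
  induction n with
  | zero =>
    simpa using coeffHomogeneous_C_mul_X_pow (n := 0) (p := 1) (isHomogeneousOfDegree_word [])
  | succ n ih => rw [pow_succ]; exact ih.mul hf

theorem isHomogeneousOfDegree_varA : IsHomogeneousOfDegree 1 varA := by
  simpa [word] using isHomogeneousOfDegree_word [0]

theorem isHomogeneousOfDegree_varB : IsHomogeneousOfDegree 1 varB := by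
  simpa [word] using isHomogeneousOfDegree_word [1]

open Polynomial in
theorem coeffHomogeneous_generating (k : ℕ) : CoeffHomogeneous (generating k) := by
  have hA : CoeffHomogeneous (C varA * X) := by
    simpa using coeffHomogeneous_C_mul_X_pow isHomogeneousOfDegree_varA
  have hB : CoeffHomogeneous (C varB * X) := by
    simpa using coeffHomogeneous_C_mul_X_pow isHomogeneousOfDegree_varB
  have hAB := coeffHomogeneous_C_mul_X_pow
    (isHomogeneousOfDegree_varA.mul isHomogeneousOfDegree_varB)
  intro m
  rw [generating, finsetSum_coeff]
  exact Submodule.sum_mem _ fun j _ =>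
    (((((hA.add hB).sub hAB).pow j).sub (hA.pow j)).sub (hB.pow j)).smul _ m

open Polynomial in
theorem natDegree_generating_le (k : ℕ) : (generating k).natDegree ≤ 2 * k - 2 := by
  refine natDegree_sum_le_of_forall_le _ _ fun j hj => ?_
  have hj := Finset.mem_Icc.1 hj
  refine (natDegree_smul_le _ _).trans ?_
  have h1 : ∀ p : NCPoly, (C p * X).natDegree ≤ 2 := fun p =>
    le_trans (by simpa using natDegree_C_mul_X_pow_le p 1) one_le_two
  have h2 : (C (varA * varB) * X ^ 2).natDegree ≤ 2 := natDegree_C_mul_X_pow_le _ _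
  have hp : ∀ f : Polynomial NCPoly, f.natDegree ≤ 2 → (f ^ j).natDegree ≤ 2 * k - 2 :=
    fun f hf => (natDegree_pow_le_of_le j hf).trans (by omega)
  refine (natDegree_sub_le_of_le (n := 2 * k - 2) (natDegree_sub_le_of_le
    (hp _ (natDegree_sub_le_of_le (natDegree_add_le_of_degree_le (h1 _) (h1 _)) h2))
    (hp _ (h1 _))) (hp _ (h1 _))).trans (by simp)

open Polynomial in
theorem coeff_zero_generating (k : ℕ) : (generating k).coeff 0 = 0 := by
  rw [generating, finsetSum_coeff]
  refine Finset.sum_eq_zero fun j hj => ?_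
  have hj : j ≠ 0 := by have := Finset.mem_Icc.1 hj; omega
  rw [coeff_smul, coeff_sub, coeff_sub]
  have hp : ∀ f : Polynomial NCPoly, f.coeff 0 = 0 → (f ^ j).coeff 0 = 0 := fun f hf => by
    rw [← constantCoeff_apply, map_pow, constantCoeff_apply, hf, zero_pow hj]
  rw [hp, hp, hp] <;> simp

open Polynomial in
theorem generating_eq_sum (k : ℕ) :
    generating k = ∑ m ∈ Finset.Icc 1 (2 * k - 2), C (P k m) * X ^ m := by
  conv_lhs => rw [(generating k).as_sum_range' (2 * k - 2 + 1)
    (Nat.lt_succ_of_le (natDegree_generating_le k))]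
  rw [Finset.sum_range_succ', coeff_zero_generating, monomial_zero_right, add_zero,
    Finset.range_eq_Ico, Finset.sum_Ico_add' (fun i => monomial i ((generating k).coeff i)) 0 _ 1]
  refine Finset.sum_congr (by ext; simp) fun m _ => ?_
  rw [P, C_mul_X_pow_eq_monomial]

theorem hasTermsOfDegreeGE_T (k : ℕ) : HasTermsOfDegreeGE k (T k) := by
  refine Submodule.sum_mem _ fun m hm => ?_
  refine Submodule.span_mono ?_ (coeffHomogeneous_generating k m)
  rintro _ ⟨l, hl, rfl⟩
  exact ⟨l, hl ▸ (Finset.mem_Icc.1 hm).1, rfl⟩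

end Homogeneity

/-! ### Evaluating non-commutative polynomials at operators. -/

section Evaluation

variable {H : Type*} [NormedAddCommGroup H] [InnerProductSpace ℂ H]

theorem eval_word (A B : H →L[ℂ] H) (l : List (Fin 2)) :
    eval A B (word l) = (l.map ![A, B]).prod := by
  rw [eval, word, map_list_prod, List.map_map]
  congr 2
  funext i
  simp

theorem map_logSum {𝔸 𝔹 : Type*} [Ring 𝔸] [Algebra ℂ 𝔸] [Ring 𝔹] [Algebra ℂ 𝔹] (φ : 𝔸 →ₐ[ℂ] 𝔹)
    (n : ℕ) (x : 𝔸) : φ (logSum n x) = logSum n (φ x) := by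
  simp [logSum]

open Polynomial in
theorem generating_eq_logSum (k : ℕ) :
    generating k = logSum (k - 1) (C varA * X + C varB * X - C (varA * varB) * X ^ 2) -
      logSum (k - 1) (C varA * X) - logSum (k - 1) (C varB * X) := by
  simp only [generating, logSum, smul_sub, Finset.sum_sub_distrib]

open Polynomial in
-- A scalar z is central, so t ↦ z extends evaluation at (A, B) to an algebra homomorphism on
-- polynomials in t. It is applied to two expressions for `generating k`.
theorem sum_smul_eval_P (k : ℕ) (A B : H →L[ℂ] H) (z : ℂ) :
    ∑ m ∈ Finset.Icc 1 (2 * k - 2), z ^ m • eval A B (P k m) =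
      logSum (k - 1) (z • A + z • B - (z • A) * (z • B)) - logSum (k - 1) (z • A) -
        logSum (k - 1) (z • B) := by
  let φ : NCPoly[X] →ₐ[ℂ] (H →L[ℂ] H) := eval₂AlgHom (FreeAlgebra.lift ℂ ![A, B])
    (algebraMap ℂ _ z) fun a => (Algebra.commutes z _).symm
  have hφ : ∀ (p : NCPoly) (m : ℕ), φ (C p * X ^ m) = z ^ m • eval A B p := fun p m => by
    have h1 : φ (C p) = eval A B p := eval₂_C _ _
    have h2 : φ X = algebraMap ℂ _ z := eval₂_X _ _
    rw [map_mul, map_pow, h1, h2, ← map_pow, ← Algebra.commutes, ← Algebra.smul_def]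
  have h := congrArg φ ((generating_eq_sum k).symm.trans (generating_eq_logSum k))
  rw [map_sum] at h
  simp only [hφ, map_sub, map_add, map_logSum] at h
  rw [h]
  have h1 : ∀ p : NCPoly, φ (C p * X) = z • eval A B p := fun p => by simpa using hφ p 1
  simp only [h1]
  simp [eval, smul_smul, pow_two]

theorem tendsto_eval {ι : Type*} {l : Filter ι} {A B : ι → H →L[ℂ] H} {A₀ B₀ : H →L[ℂ] H}
    (hA : Tendsto A l (𝓝 A₀)) (hB : Tendsto B l (𝓝 B₀)) (Q : NCPoly) :
    Tendsto (fun i => eval (A i) (B i) Q) l (𝓝 (eval A₀ B₀ Q)) := by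
  induction Q using FreeAlgebra.induction with
  | grade0 r => simp only [eval, AlgHom.commutes]; exact tendsto_const_nhds
  | grade1 i => fin_cases i <;> simpa [eval]
  | mul p q hp hq => simpa [eval] using hp.mul hq
  | add p q hp hq => simpa [eval] using hp.add hq

theorem UnifSchatten.eval {ι : Type*} {k : ℕ} (hk : 1 ≤ k) {A B : ι → H →L[ℂ] H}
    (hA : UnifSchatten k A) (hB : UnifSchatten k B) {Q : NCPoly} (hQ : HasTermsOfDegreeGE k Q) :
    UnifSchatten 1 (fun i => eval (A i) (B i) Q) := by
  obtain ⟨b, hb0, hb, hAb⟩ := hA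
  obtain ⟨c, hc0, hc, hBc⟩ := hB
  induction hQ using Submodule.span_induction with
  | mem q hq =>
    obtain ⟨l, hl, rfl⟩ := hq
    simp only [eval_word]
    refine UnifSchatten.list_prod hk hl (fun n => add_nonneg (hb0 n) (hc0 n))
      (summable_add_pow hb0 hc0 hb hc) _ (fun i => List.length_map ..) fun i X hX n => ?_
    obtain ⟨j, -, rfl⟩ := List.mem_map.1 hX
    fin_cases j
    · exact (hAb i n).trans (le_add_of_nonneg_right (hc0 n))
    · exact (hBc i n).trans (le_add_of_nonneg_left (hb0 n))
  | zero => simpa [SchattenDet.eval] using UnifSchatten.zero le_rfl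
  | add p q _ _ hp hq => simpa [SchattenDet.eval] using hp.add hq
  | smul a p _ hp => simpa [SchattenDet.eval] using hp.smul a

end Evaluation

/-! ### Invariance of matrix traces under cyclic permutation. -/

section Cyclic

variable {H : Type*} [NormedAddCommGroup H] [InnerProductSpace ℂ H] [CompleteSpace H]
  {s : Finset (basisSet H)}

theorem trace_compression_eval_eq_of_cyclicEquiv {A B : H →L[ℂ] H} (hA : Commute (proj s) A)
    (hB : Commute (proj s) B) {Q R : NCPoly} (h : CyclicEquiv Q R) :
    (compression s (eval A B Q)).trace = (compression s (eval A B R)).trace := by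
  classical
  set f := FreeAlgebra.lift ℂ ![compression s A, compression s B]
  have hle : Submodule.span ℂ
      {r : NCPoly | ∃ l l' : List (Fin 2), List.IsRotated l l' ∧ r = word l - word l'} ≤
      LinearMap.ker ((Matrix.traceLinearMap s ℂ ℂ) ∘ₗ f.toLinearMap) := by
    refine Submodule.span_le.2 ?_
    rintro _ ⟨l, l', ⟨n, rfl⟩, rfl⟩
    have h1 : word (l.rotate n) = word (l.drop (n % l.length)) * word (l.take (n % l.length)) := by
      rw [List.rotate_eq_drop_append_take_mod, word_append]
    have h2 : word l = word (l.take (n % l.length)) * word (l.drop (n % l.length)) := by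
      rw [← word_append, List.take_append_drop]
    change (f (word l - word (l.rotate n))).trace = 0
    rw [h1, h2, map_sub, map_mul, map_mul, Matrix.trace_sub, Matrix.trace_mul_comm, sub_self]
  have h0 : (f (Q - R)).trace = 0 := hle h
  rw [compression_eval hA hB, compression_eval hA hB, ← sub_eq_zero, ← Matrix.trace_sub, ← map_sub]
  exact h0

end Cyclic

/-! ### The determinant formula. -/

section Formula

open Asymptotics

variable {H : Type*} [NormedAddCommGroup H] [InnerProductSpace ℂ H]

theorem UnifSchatten.add_sub_mul {ι : Type*} {k : ℕ} {A B : ι → H →L[ℂ] H}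
    (hA : UnifSchatten k A) (hB : UnifSchatten k B) {C : ℝ} (hC : 0 ≤ C) (hBC : ∀ i, ‖B i‖ ≤ C) :
    UnifSchatten k (fun i => A i + B i - A i * B i) :=
  (hA.add hB).sub (hA.mul_bounded hBC hC)

variable [CompleteSpace H] {s : Finset (basisSet H)}

theorem isBigO_compressionDet_regularize {k : ℕ} (hk : 1 ≤ k) {W : ℂ → H →L[ℂ] H}
    (hW : UnifSchatten k (fun z : Metric.closedBall (0 : ℂ) 1 => W z)) :
    (fun z : ℂ => compressionDet (regularize k (1 - z • W z)) s - 1) =O[𝓝[≠] 0]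
      fun z : ℂ => z ^ k := by
  obtain ⟨C, hC⟩ := exists_norm_compressionDet_regularize_sub_one_le hk hW
  refine IsBigO.of_bound C ?_
  filter_upwards [self_mem_nhdsWithin,
    mem_nhdsWithin_of_mem_nhds (Metric.closedBall_mem_nhds (0 : ℂ) one_pos)] with z hz hz1
  exact hC ⟨z, hz1⟩ s hz

/-- From c₁ = c₂ c₃ e one has (e - 1) c₂ c₃ = (c₁ - 1) - (c₂ - 1) c₃ - (c₃ - 1), and c₂ c₃ tends to
1. -/
theorem isBigO_sub_one_div {α : Type*} {l : Filter α} {c₁ c₂ c₃ e g : α → ℂ}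
    (hg : Tendsto g l (𝓝 0)) (h : ∀ z, c₁ z = c₂ z * c₃ z * e z)
    (h₁ : (fun z => c₁ z - 1) =O[l] g) (h₂ : (fun z => c₂ z - 1) =O[l] g)
    (h₃ : (fun z => c₃ z - 1) =O[l] g) : (fun z => e z - 1) =O[l] g := by
  have ht₂ : Tendsto c₂ l (𝓝 1) := by simpa using (h₂.trans_tendsto hg).add_const 1
  have ht₃ : Tendsto c₃ l (𝓝 1) := by simpa using (h₃.trans_tendsto hg).add_const 1
  have hinv : Tendsto (fun z => (c₂ z * c₃ z)⁻¹) l (𝓝 1) := by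
    simpa using (ht₂.mul ht₃).inv₀ (by simp)
  have hne : ∀ᶠ z in l, c₂ z * c₃ z ≠ 0 := by
    have : Tendsto (fun z => c₂ z * c₃ z) l (𝓝 1) := by simpa using ht₂.mul ht₃
    exact this.eventually_ne one_ne_zero
  have hmain : (fun z => (c₁ z - 1 - (c₂ z - 1) * c₃ z - (c₃ z - 1)) * (c₂ z * c₃ z)⁻¹)
      =O[l] g := by
    have h4 := (h₁.sub (by simpa using h₂.mul (ht₃.isBigO_one ℂ))).sub h₃
    simpa using h4.mul (hinv.isBigO_one ℂ)
  refine hmain.congr' ?_ EventuallyEq.rfl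
  filter_upwards [hne] with z hz
  have h5 : c₁ z - 1 - (c₂ z - 1) * c₃ z - (c₃ z - 1) = (e z - 1) * (c₂ z * c₃ z) := by
    rw [h z]; ring
  rw [h5, mul_inv_cancel_right₀ hz]

/-- The traces of `P_m(A, B)` vanish for `m < k`, because `det_k (I - z A) = 1 + O(z ^ k)`. -/
theorem trace_compression_eval_P_eq_zero {k : ℕ} (hk : 1 ≤ k) {A B : H →L[ℂ] H}
    (hSA : IsSchatten k A) (hSB : IsSchatten k B) (hA : Commute (proj s) A)
    (hB : Commute (proj s) B) {m : ℕ} (hm : m ∈ Finset.Icc 1 (2 * k - 2)) (hmk : m < k) :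
    (compression s (eval A B (P k m))).trace = 0 := by
  set p : Polynomial ℂ := ∑ m ∈ Finset.Icc 1 (2 * k - 2),
    Polynomial.C (compression s (eval A B (P k m))).trace * Polynomial.X ^ m with hp
  have hcoeff : p.coeff m = (compression s (eval A B (P k m))).trace := by
    simp only [hp, Polynomial.finsetSum_coeff, Polynomial.coeff_C_mul_X_pow]
    rw [Finset.sum_ite_eq, if_pos hm]
  have hp0 : p.eval 0 = 0 := by
    rw [hp, Polynomial.eval_finsetSum]
    refine Finset.sum_eq_zero fun j hj => ?_
    have := (Finset.mem_Icc.1 hj).1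
    simp [zero_pow (by omega : j ≠ 0)]
  have hpz : ∀ z, p.eval z = (compression s (logSum (k - 1) (z • A + z • B - (z • A) * (z • B)) -
      logSum (k - 1) (z • A) - logSum (k - 1) (z • B))).trace := fun z => by
    rw [← sum_smul_eval_P, map_sum, Matrix.trace_sum, hp, Polynomial.eval_finsetSum]
    refine Finset.sum_congr rfl fun j _ => ?_
    rw [Polynomial.eval_mul, Polynomial.eval_C, Polynomial.eval_pow, Polynomial.eval_X, map_smul,
      Matrix.trace_smul, smul_eq_mul, mul_comm]
  rw [← hcoeff]
  refine coeff_eq_zero_of_exp_eval_isBigO hp0 ?_ hmk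
  have hg : Tendsto (fun z : ℂ => z ^ k) (𝓝[≠] 0) (𝓝 0) := by
    have : Tendsto (fun z : ℂ => z ^ k) (𝓝 0) (𝓝 (0 ^ k)) := (continuous_pow k).tendsto 0
    rw [zero_pow (by omega)] at this
    exact this.mono_left nhdsWithin_le_nhds
  have hzB : ∀ z : Metric.closedBall (0 : ℂ) 1, ‖(z : ℂ) • B‖ ≤ ‖B‖ := fun z =>
    (norm_smul_le _ _).trans (mul_le_of_le_one_left (norm_nonneg _) (mem_closedBall_zero_iff.1 z.2))
  -- With this W, zW = zA + zB - (zA)(zB), so 1 - zW is the product (1 - zA)(1 - zB).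
  refine isBigO_sub_one_div hg (fun z => ?_)
    (isBigO_compressionDet_regularize (s := s) hk (W := fun z => A + B - A * (z • B))
      (((IsSchatten.unif hSA).add (IsSchatten.unif hSB)).sub
        ((IsSchatten.unif hSA).mul_bounded hzB (norm_nonneg B))))
    (isBigO_compressionDet_regularize (s := s) hk (W := fun _ => A) (IsSchatten.unif hSA))
    (isBigO_compressionDet_regularize (s := s) hk (W := fun _ => B) (IsSchatten.unif hSB))
  have := compressionDet_regularize_mul k (hA.smul_right z) (hB.smul_right z)
  rw [hpz, ← this, smul_sub, smul_add, smul_mul_assoc]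

theorem compressionDet_regularize_formula {k : ℕ} (hk : 1 ≤ k) {A B : H →L[ℂ] H}
    (hSA : IsSchatten k A) (hSB : IsSchatten k B) (hA : Commute (proj s) A)
    (hB : Commute (proj s) B) :
    compressionDet (regularize k (1 - (A + B - A * B))) s =
      compressionDet (regularize k (1 - A)) s * compressionDet (regularize k (1 - B)) s *
        Complex.exp (compression s (eval A B (T k))).trace := by
  rw [compressionDet_regularize_mul k hA hB]
  congr 2
  have h := sum_smul_eval_P k A B 1
  simp only [one_pow, one_smul] at h
  rw [← h, T, eval, map_sum, map_sum, map_sum, Matrix.trace_sum, Matrix.trace_sum]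
  symm
  refine Finset.sum_subset (Finset.Icc_subset_Icc_left hk) fun m hm hmk => ?_
  refine trace_compression_eval_P_eq_zero hk hSA hSB hA hB hm ?_
  simp only [Finset.mem_Icc, not_and, not_le] at hm hmk
  by_contra! hkm
  exact absurd (hmk hkm) (by omega)

/-- The matrix formula for `trunc s A` and `trunc s B` passes to the limit in s. Cyclicity of the
trace is used only for matrices, before the limit. -/
theorem isDetCorrection_of_cyclicEquiv {k : ℕ} (hk : 1 ≤ k) {Q : NCPoly}
    (hQ : HasTermsOfDegreeGE k Q) (hQT : CyclicEquiv Q (T k)) : IsDetCorrection H k Q := by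
  intro A B hA hB
  have hAt := hA.unif_trunc
  have hBt := hB.unif_trunc
  have hAl := tendsto_trunc hA
  have hBl := tendsto_trunc hB
  have hQAB : IsTraceClass (eval A B Q) :=
    ((IsSchatten.unif (ι := Unit) hA).eval hk (IsSchatten.unif hB) hQ).isSchatten ()
  refine ⟨hQAB, ?_⟩
  have h0 : (1 - A) * (1 - B) = 1 - (A + B - A * B) := by noncomm_ring
  have h1 := tendsto_detk hk (hAt.add_sub_mul hBt (norm_nonneg B) fun s => norm_trunc_le s B)
    (((IsSchatten.unif (ι := Unit) hA).add_sub_mul (IsSchatten.unif hB) (norm_nonneg B)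
      fun _ => le_rfl).isSchatten ()) ((hAl.add hBl).sub (hAl.mul hBl))
  have h2 := tendsto_detk hk hAt hA hAl
  have h3 := tendsto_detk hk hBt hB hBl
  have h4 := tendsto_sum_entry_of_tendsto (hAt.eval hk hBt hQ) hQAB (tendsto_eval hAl hBl Q)
  rw [h0]
  refine tendsto_nhds_unique h1 (((h2.mul h3).mul h4.cexp).congr fun s => ?_)
  rw [compressionDet_regularize_formula hk (hAt.isSchatten s) (hBt.isSchatten s)
    (commute_proj_trunc s A) (commute_proj_trunc s B),
    ← trace_compression_eval_eq_of_cyclicEquiv (commute_proj_trunc s A) (commute_proj_trunc s B) hQT,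
    trace_compression]

theorem CyclicEquiv.refl (Q : NCPoly) : CyclicEquiv Q Q := by
  rw [CyclicEquiv, sub_self]; exact Submodule.zero_mem _

end Formula

/-! ### A coefficient criterion for cyclic equivalence to zero. -/

section Words

theorem exists_finsupp_eq_sum_word (Q : NCPoly) :
    ∃ d : List (Fin 2) →₀ ℂ, Q = d.sum fun l a => a • word l := by
  have hmem : Q ∈ Submodule.span ℂ (Set.range word) := by
    have hsub : ∀ l, word l ∈ Submodule.span ℂ (Set.range word) := fun l =>
      Submodule.subset_span ⟨l, rfl⟩
    induction Q using FreeAlgebra.induction with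
    | grade0 r =>
      rw [Algebra.algebraMap_eq_smul_one]
      exact Submodule.smul_mem _ r (hsub [])
    | grade1 i => simpa [word] using hsub [i]
    | mul p q hp hq =>
      have h := Submodule.mul_mem_mul hp hq
      rw [Submodule.span_mul_span] at h
      refine Submodule.span_mono ?_ h
      rintro _ ⟨_, ⟨l, rfl⟩, _, ⟨l', rfl⟩, rfl⟩
      exact ⟨l ++ l', word_append l l'⟩
    | add p q hp hq => exact Submodule.add_mem _ hp hq
  obtain ⟨d, hd⟩ := Finsupp.mem_span_range_iff_exists_finsupp.1 hmem
  exact ⟨d, hd.symm⟩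

/-- The linear combinations of differences of words that are cyclic permutations of each other. -/
def cyclicSpan : Submodule ℂ NCPoly :=
  Submodule.span ℂ {r : NCPoly | ∃ l l' : List (Fin 2), List.IsRotated l l' ∧ r = word l - word l'}

theorem mkQ_word_rotate (l : List (Fin 2)) (n : ℕ) :
    cyclicSpan.mkQ (word (l.rotate n)) = cyclicSpan.mkQ (word l) := by
  symm
  rw [← sub_eq_zero, ← map_sub, Submodule.mkQ_apply, Submodule.Quotient.mk_eq_zero]
  exact Submodule.subset_span ⟨l, l.rotate n, ⟨n, rfl⟩, rfl⟩

/-- Modulo `cyclicSpan` a word equals each of its rotations. Averaging over rotations replaces the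
coefficient of a non-empty word by the mean over its orbit, which is zero. -/
theorem sum_word_mem_cyclicSpan (d : List (Fin 2) →₀ ℂ) (h0 : d [] = 0)
    (h : ∀ w : List (Fin 2), w ≠ [] → ∑ i ∈ Finset.range w.length, d (w.rotate i) = 0) :
    (d.sum fun l a => a • word l) ∈ cyclicSpan := by
  classical
  set N := d.support.sup List.length with hN
  -- Unlike the support of d, the set of all words of length at most N is stable under rotation, so
  -- sums over it can be reindexed.
  set W : Finset (List (Fin 2)) := (List.finite_length_le (Fin 2) N).toFinset with hW
  have hWmem : ∀ l, l ∈ W ↔ l.length ≤ N := fun l => by simp [hW]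
  have hsum : (d.sum fun l a => a • word l) = ∑ l ∈ W, d l • word l :=
    Finsupp.sum_of_support_subset _ (fun l hl => (hWmem l).2 (Finset.le_sup (f := List.length) hl)) _
      (by simp)
  rw [← Submodule.Quotient.mk_eq_zero, ← Submodule.mkQ_apply, hsum, map_sum]
  simp only [map_smul]
  have hrot : ∀ (i : ℕ) (f : ℕ → ℂ),
      ∑ l ∈ W, (f l.length * d l) • cyclicSpan.mkQ (word l) =
        ∑ l ∈ W, (f l.length * d (l.rotate i)) • cyclicSpan.mkQ (word l) := fun i f => by
    symm
    have hmaps : Set.MapsTo (fun l : List (Fin 2) => l.rotate i) W W := fun l hl => by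
      simpa [hWmem] using hl
    have hinj : Set.InjOn (fun l : List (Fin 2) => l.rotate i) W :=
      (List.rotate_injective i).injOn
    refine Finset.sum_nbij (fun l => l.rotate i) hmaps hinj
      (Finset.surjOn_of_injOn_of_card_le _ hmaps hinj le_rfl) fun l _ => ?_
    rw [List.length_rotate, mkQ_word_rotate]
  calc ∑ l ∈ W, d l • cyclicSpan.mkQ (word l)
      = ∑ l ∈ W, ∑ i ∈ Finset.range N,
          ((if i < l.length then (l.length : ℂ)⁻¹ else 0) * d l) • cyclicSpan.mkQ (word l) := by
        refine Finset.sum_congr rfl fun l hl => ?_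
        rw [← Finset.sum_smul, ← Finset.sum_mul, ← Finset.sum_filter]
        rcases eq_or_ne l [] with rfl | hl0
        · simp [h0]
        · have hlen : (l.length : ℂ) ≠ 0 := by simpa using hl0
          have : (Finset.range N).filter (fun i => i < l.length) = Finset.range l.length := by
            ext i
            have := (hWmem l).1 hl
            simp only [Finset.mem_filter, Finset.mem_range]
            omega
          rw [this, Finset.sum_const, Finset.card_range, nsmul_eq_mul, mul_inv_cancel₀ hlen,
            one_mul]
    _ = ∑ i ∈ Finset.range N, ∑ l ∈ W,
          ((if i < l.length then (l.length : ℂ)⁻¹ else 0) * d (l.rotate i)) •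
            cyclicSpan.mkQ (word l) := by
        rw [Finset.sum_comm]
        exact Finset.sum_congr rfl fun i _ =>
          hrot i fun n => if i < n then (n : ℂ)⁻¹ else 0
    _ = 0 := by
        rw [Finset.sum_comm]
        refine Finset.sum_eq_zero fun l hl => ?_
        simp only [ite_mul, zero_mul]
        rw [← Finset.sum_smul, ← Finset.sum_filter]
        rcases eq_or_ne l [] with rfl | hl0
        · simp
        · have : (Finset.range N).filter (fun i => i < l.length) = Finset.range l.length := by
            ext i
            have := (hWmem l).1 hl
            simp only [Finset.mem_filter, Finset.mem_range]
            omega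
          rw [this, ← Finset.mul_sum, h l hl0, mul_zero, zero_smul]

end Words

/-! ### Matrix units along a labelled cycle. -/

section Shift

variable {H : Type*} [NormedAddCommGroup H] [InnerProductSpace ℂ H]

theorem isSchatten_rankOne {k : ℕ} (hk : 1 ≤ k) (x y : H) :
    IsSchatten k (InnerProductSpace.rankOne ℂ x y) := by
  refine summable_of_ne_finset_zero (s := {0}) fun n hn => ?_
  have hn : 1 ≤ n := Nat.one_le_iff_ne_zero.2 (by simpa using hn)
  have hr : LinearMap.rank (InnerProductSpace.rankOne ℂ x y : H →ₗ[ℂ] H) ≤ (n : Cardinal) := by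
    have h1 : LinearMap.range (InnerProductSpace.rankOne ℂ x y : H →ₗ[ℂ] H) ≤ ℂ ∙ x := by
      rintro _ ⟨v, rfl⟩
      exact Submodule.mem_span_singleton.2 ⟨inner ℂ y v, by simp⟩
    refine (Submodule.rank_mono h1).trans ((rank_span_le _).trans ?_)
    rw [Cardinal.mk_singleton]
    exact_mod_cast hn
  have h0 := singularNumber_le_norm_sub (InnerProductSpace.rankOne ℂ x y) _ hr
  rw [sub_self, norm_zero] at h0
  rw [le_antisymm h0 (singularNumber_nonneg _ _), zero_pow (by omega)]

variable [CompleteSpace H]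

/-- The sum of the matrix units `E_{i, i + 1}`, `i` modulo `m`, over the `i < m` with `g i = c`. -/
noncomputable def cyclicShift {m : ℕ} [NeZero m] (e : ZMod m ↪ basisSet H) (g : ZMod m → Fin 2)
    (c : Fin 2) : H →L[ℂ] H :=
  ∑ i : ZMod m with g i = c, InnerProductSpace.rankOne ℂ (onb H (e i)) (onb H (e (i + 1)))

variable {m : ℕ} [NeZero m] (e : ZMod m ↪ basisSet H) (g : ZMod m → Fin 2)

theorem isSchatten_cyclicShift {k : ℕ} (hk : 1 ≤ k) (c : Fin 2) :
    IsSchatten k (cyclicShift e g c) :=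
  (UnifSchatten.sum (ι := Unit) hk _ fun i _ =>
    IsSchatten.unif (isSchatten_rankOne hk (onb H (e i)) (onb H (e (i + 1))))).isSchatten ()

theorem cyclicShift_apply_add_one (c : Fin 2) (j : ZMod m) :
    cyclicShift e g c (onb H (e (j + 1))) = if g j = c then onb H (e j) else 0 := by
  classical
  rw [cyclicShift, sum_apply]
  simp [inner_onb]

theorem cyclicShift_apply_of_notMem (c : Fin 2) {b : basisSet H} (hb : b ∉ Set.range e) :
    cyclicShift e g c (onb H b) = 0 := by
  classical
  rw [cyclicShift, sum_apply]
  refine Finset.sum_eq_zero fun i _ => ?_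
  have : e (i + 1) ≠ b := fun h => hb ⟨_, h⟩
  simp [inner_onb, this]

open Classical in
-- Each factor moves one step back along the cycle and survives only if its letter is the label of
-- that step.
theorem list_prod_cyclicShift_apply (l : List (Fin 2)) (j : ZMod m) :
    (l.map (cyclicShift e g)).prod (onb H (e (j + (l.length : ZMod m)))) =
      if ∀ i (hi : i < l.length), l[i] = g (j + (i : ZMod m)) then onb H (e j) else 0 := by
  induction l generalizing j with
  | nil => simp
  | cons c l ih =>
    have h1 : j + ((c :: l).length : ZMod m) = (j + 1) + (l.length : ZMod m) := by
      rw [List.length_cons]; push_cast; ring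
    rw [List.map_cons, List.prod_cons, mul_apply_eq_comp, h1, ih]
    have h2 : (∀ i (hi : i < (c :: l).length), (c :: l)[i] = g (j + (i : ZMod m))) ↔
        g j = c ∧ ∀ i (hi : i < l.length), l[i] = g (j + 1 + (i : ZMod m)) := by
      constructor
      · intro h
        refine ⟨?_, fun i hi => ?_⟩
        · have := h 0 (by simp)
          rw [List.getElem_cons_zero, Nat.cast_zero, add_zero] at this
          exact this.symm
        · have := h (i + 1) (by simpa using hi)
          rw [List.getElem_cons_succ] at this
          rw [this, add_assoc, add_comm 1, Nat.cast_add, Nat.cast_one]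
      · rintro ⟨h, h'⟩ i hi
        cases i with
        | zero => rw [Nat.cast_zero, add_zero]; exact h.symm
        | succ i =>
          rw [List.getElem_cons_succ, h' i (by simpa using hi), add_assoc, add_comm 1,
            Nat.cast_add, Nat.cast_one]
    rw [if_congr h2 rfl rfl, ite_and]
    split_ifs with h3 h4
    · rw [cyclicShift_apply_add_one, if_pos h4]
    · rw [cyclicShift_apply_add_one, if_neg h4]
    · simp
    · simp

end Shift

/-! ### Traces of words count rotations. -/

section CyclicTrace

variable {H : Type*} [NormedAddCommGroup H] [InnerProductSpace ℂ H] [CompleteSpace H]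

theorem list_prod_cyclicShift_apply_of_notMem {m : ℕ} [NeZero m] (e : ZMod m ↪ basisSet H)
    (g : ZMod m → Fin 2) {l : List (Fin 2)} (hl : l ≠ []) {b : basisSet H}
    (hb : b ∉ Set.range e) : (l.map (cyclicShift e g)).prod (onb H b) = 0 := by
  obtain ⟨l, c, rfl⟩ := (List.eq_nil_or_concat l).resolve_left hl
  rw [List.concat_eq_append, List.map_append, List.prod_append, mul_apply_eq_comp]
  simp [cyclicShift_apply_of_notMem e g c hb]

theorem eq_rotate_iff {w l : List (Fin 2)} [NeZero w.length] (hl : l.length = w.length)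
    (j : ZMod w.length) :
    (∀ i (hi : i < l.length), l[i] = w[(j + (i : ZMod w.length)).val]'(ZMod.val_lt _)) ↔
      l = w.rotate j.val := by
  have hget : ∀ i (hi : i < l.length), (w.rotate j.val)[i]'(by simpa [← hl] using hi) =
      w[(j + (i : ZMod w.length)).val]'(ZMod.val_lt _) := fun i hi => by
    rw [List.getElem_rotate]
    congr 1
    rw [ZMod.val_add, ZMod.val_natCast, Nat.add_mod_mod, add_comm]
  constructor
  · intro h
    exact List.ext_getElem (by simp [hl]) fun i h1 h2 => by rw [h i h1, hget i h1]
  · intro h i hi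
    rw [← hget i hi]
    congr 1

open Classical in
-- A word of length |w| goes once around the cycle, so it returns to its starting vector e j exactly
-- when it spells w read from position j, and otherwise gives 0.
theorem trace_list_prod_cyclicShift {w l : List (Fin 2)} [NeZero w.length]
    (e : ZMod w.length ↪ basisSet H) (hl : l.length = w.length) :
    trace ((l.map (cyclicShift e fun j => w[j.val]'(ZMod.val_lt j))).prod) =
      ∑ i ∈ Finset.range w.length, if l = w.rotate i then (1 : ℂ) else 0 := by
  have hl0 : l ≠ [] := fun h => NeZero.ne w.length (by rw [← hl, h, List.length_nil])
  have hsupp : Function.support (fun b : basisSet H =>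
      entry ((l.map (cyclicShift e fun j => w[j.val]'(ZMod.val_lt j))).prod) b b) ⊆
      Set.range e := fun b hb => by
    by_contra hbe
    exact hb (by simp [entry, list_prod_cyclicShift_apply_of_notMem e _ hl0 hbe])
  rw [trace, ← e.injective.tsum_eq hsupp, tsum_fintype]
  have hent : ∀ j : ZMod w.length,
      entry ((l.map (cyclicShift e fun j => w[j.val]'(ZMod.val_lt j))).prod) (e j) (e j) =
        if l = w.rotate j.val then (1 : ℂ) else 0 := fun j => by
    have h := list_prod_cyclicShift_apply e (fun j => w[j.val]'(ZMod.val_lt j)) l j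
    have hl' : (l.length : ZMod w.length) = 0 := by rw [hl, ZMod.natCast_self]
    rw [hl', add_zero, if_congr (eq_rotate_iff hl j) rfl rfl] at h
    rw [entry, h]
    split_ifs <;> simp [(onb H).orthonormal.1]
  simp only [hent]
  refine Finset.sum_bij (fun j _ => j.val) (fun j _ => Finset.mem_range.2 (ZMod.val_lt j))
    (fun i _ j _ h => ZMod.val_injective _ h) (fun i hi => ⟨(i : ZMod w.length), by simp, ?_⟩)
    (fun _ _ => rfl)
  exact ZMod.val_natCast_of_lt (Finset.mem_range.1 hi)

theorem infinite_basisSet (h : ¬ FiniteDimensional ℂ H) : Infinite (basisSet H) := by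
  by_contra hfin
  rw [not_infinite_iff_finite] at hfin
  have := Fintype.ofFinite (basisSet H)
  exact h (Module.Finite.of_basis (onb H).toOrthonormalBasis.toBasis)

end CyclicTrace

/-! ### Uniqueness up to cyclic permutations. -/

section Uniqueness

open Asymptotics

variable {H : Type*} [NormedAddCommGroup H] [InnerProductSpace ℂ H]

theorem eval_smul_smul_word (A B : H →L[ℂ] H) (z : ℂ) (l : List (Fin 2)) :
    eval (z • A) (z • B) (word l) = z ^ l.length • eval A B (word l) := by
  simp only [eval_word]
  induction l with
  | nil => simp
  | cons c l ih =>
    rw [List.map_cons, List.prod_cons, ih, List.map_cons, List.prod_cons, List.length_cons, pow_succ',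
      mul_smul, mul_smul_comm]
    fin_cases c <;> simp [smul_comm z]

theorem eval_zero_zero_word (l : List (Fin 2)) :
    eval (0 : H →L[ℂ] H) 0 (word l) = if l = [] then 1 else 0 := by
  rw [eval_word]
  cases l with
  | nil => simp
  | cons c l => fin_cases c <;> simp

variable [CompleteSpace H]

theorem trace_sum_smul {κ : Type*} (t : Finset κ) (c : κ → ℂ) (X : κ → H →L[ℂ] H)
    (hX : ∀ j ∈ t, IsTraceClass (X j)) :
    trace (∑ j ∈ t, c j • X j) = ∑ j ∈ t, c j * trace (X j) := by
  have h : ∀ i, entry (∑ j ∈ t, c j • X j) i i = ∑ j ∈ t, c j * entry (X j) i i := fun i => by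
    simp [entry, sum_apply]
  simp only [trace, h]
  rw [Summable.tsum_finsetSum fun j hj => (hX j hj).summable_entry.mul_left _]
  simp only [tsum_mul_left]

/-- Serves to make the determinants non-zero for small z, so that they can be cancelled. -/
theorem tendsto_detk_one_sub_smul {k : ℕ} (hk : 1 ≤ k) {A : H →L[ℂ] H} (hA : IsSchatten k A) :
    Tendsto (fun z : ℂ => detk k (1 - z • A)) (𝓝[≠] 0) (𝓝 1) := by
  obtain ⟨C, hC⟩ := exists_norm_compressionDet_regularize_sub_one_le hk
    (IsSchatten.unif (ι := Metric.closedBall (0 : ℂ) 1) hA)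
  rw [tendsto_iff_norm_sub_tendsto_zero]
  have hg : Tendsto (fun z : ℂ => C * ‖z ^ k‖) (𝓝[≠] 0) (𝓝 0) := by
    have : Tendsto (fun z : ℂ => C * ‖z ^ k‖) (𝓝 0) (𝓝 (C * ‖(0 : ℂ) ^ k‖)) := by
      have hc : Continuous fun z : ℂ => C * ‖z ^ k‖ := by fun_prop
      exact hc.tendsto 0
    rw [zero_pow (by omega), norm_zero, mul_zero] at this
    exact this.mono_left nhdsWithin_le_nhds
  refine squeeze_zero' (Eventually.of_forall fun z => norm_nonneg _) ?_ hg
  filter_upwards [self_mem_nhdsWithin,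
    mem_nhdsWithin_of_mem_nhds (Metric.closedBall_mem_nhds (0 : ℂ) one_pos)] with z hz hz1
  have hzA : IsSchatten k (z • A) := ((IsSchatten.unif (ι := Unit) hA).smul z).isSchatten ()
  have ht := tendsto_detk hk (IsSchatten.unif hzA) hzA tendsto_const_nhds
  exact le_of_tendsto (ht.sub_const 1).norm (Eventually.of_forall fun s => hC ⟨z, hz1⟩ s hz)

theorem cyclicEquiv_of_isDetCorrection (hH : ¬ FiniteDimensional ℂ H) {k : ℕ} (hk : 1 ≤ k)
    {Q R : NCPoly} (hQ : IsDetCorrection H k Q) (hR : IsDetCorrection H k R) :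
    CyclicEquiv Q R := by
  classical
  have hinf := infinite_basisSet hH
  obtain ⟨d, hd⟩ := exists_finsupp_eq_sum_word (Q - R)
  have heval : ∀ A B : H →L[ℂ] H, eval A B Q - eval A B R =
      ∑ l ∈ d.support, d l • eval A B (word l) := fun A B => by
    have : eval A B Q - eval A B R = eval A B (Q - R) := by simp [eval]
    rw [this, hd, Finsupp.sum, eval, map_sum]
    simp [eval]
  have htrace : ∀ A B : H →L[ℂ] H, IsSchatten k A → IsSchatten k B →
      IsTraceClass (eval A B Q - eval A B R) := fun A B hA hB => by
    have := (hQ A B hA hB).1.add ((hR A B hA hB).1.smul (-1))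
    rwa [neg_one_smul, ← sub_eq_add_neg] at this
  -- At A = B = 0 only the constant term survives, and a non-zero multiple of the identity is not
  -- trace class in infinite dimension.
  have hd0 : d [] = 0 := by
    have hz : IsSchatten k (0 : H →L[ℂ] H) :=
      (UnifSchatten.zero (ι := Unit) hk).isSchatten ()
    have h0 := (htrace 0 0 hz hz).summable_entry
    rw [heval] at h0
    simp only [eval_zero_zero_word] at h0
    have h1 : (∑ l ∈ d.support, d l • if l = [] then (1 : H →L[ℂ] H) else 0) = d [] • 1 := by
      simp only [smul_ite, smul_zero, Finset.sum_ite_eq', Finsupp.mem_support_iff]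
      split_ifs with h
      · rfl
      · rw [not_not.1 h, zero_smul]
    rw [h1] at h0
    have h2 : ∀ i : basisSet H, entry (d [] • (1 : H →L[ℂ] H)) i i = d [] := fun i => by
      simp [entry, (onb H).orthonormal.1]
    simpa only [h2, summable_const_iff] using h0
  rw [CyclicEquiv, hd]
  refine sum_word_mem_cyclicSpan d hd0 fun w hw => ?_
  have hne : NeZero w.length := ⟨by simpa using hw⟩
  let e : ZMod w.length ↪ basisSet H :=
    Function.Embedding.trans ⟨ZMod.val, ZMod.val_injective _⟩ (Infinite.natEmbedding (basisSet H))
  set S := cyclicShift e fun j => w[j.val]'(ZMod.val_lt j) with hS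
  have hSA : ∀ (n : ℕ) (_ : 1 ≤ n) c, IsSchatten n (S c) := fun n hn c => isSchatten_cyclicShift e _ hn c
  have hWtr : ∀ l ∈ d.support, IsTraceClass (eval (S 0) (S 1) (word l)) := fun l hl => by
    refine ((IsSchatten.unif (ι := Unit) (hSA 1 le_rfl 0)).eval le_rfl
      (IsSchatten.unif (hSA 1 le_rfl 1)) ?_).isSchatten ()
    refine Submodule.subset_span ⟨l, ?_, rfl⟩
    rcases l with _ | ⟨c, l⟩
    · exact absurd hd0 (Finsupp.mem_support_iff.1 hl)
    · simp
  -- p(z) is the difference of the two traces at (zA, zB). It has no constant term, and exp p(z) = 1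
  -- near 0; its coefficient at z^|w| is then isolated.
  set p : Polynomial ℂ := ∑ l ∈ d.support,
    Polynomial.C (d l * trace (eval (S 0) (S 1) (word l))) * Polynomial.X ^ l.length with hp
  have hpeval : ∀ z, p.eval z =
      trace (eval (z • S 0) (z • S 1) Q) - trace (eval (z • S 0) (z • S 1) R) := fun z => by
    have hzS : ∀ c, IsSchatten k (z • S c) := fun c =>
      ((IsSchatten.unif (ι := Unit) (hSA k hk c)).smul z).isSchatten ()
    have h1 : trace (eval (z • S 0) (z • S 1) Q - eval (z • S 0) (z • S 1) R) =
        trace (eval (z • S 0) (z • S 1) Q) - trace (eval (z • S 0) (z • S 1) R) := by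
      simp only [trace, entry, sub_apply, inner_sub_right]
      exact Summable.tsum_sub (hQ _ _ (hzS 0) (hzS 1)).1.summable_entry
        (hR _ _ (hzS 0) (hzS 1)).1.summable_entry
    rw [← h1, heval]
    simp only [eval_smul_smul_word, smul_smul]
    rw [trace_sum_smul _ _ _ hWtr, hp, Polynomial.eval_finsetSum]
    refine Finset.sum_congr rfl fun l _ => ?_
    rw [Polynomial.eval_mul, Polynomial.eval_C, Polynomial.eval_pow, Polynomial.eval_X]
    ring
  have hp0 : p.eval 0 = 0 := by
    rw [hp, Polynomial.eval_finsetSum]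
    refine Finset.sum_eq_zero fun l hl => ?_
    have : l.length ≠ 0 := fun h => by
      rw [List.length_eq_zero_iff.1 h] at hl
      exact (Finsupp.mem_support_iff.1 hl) hd0
    simp [zero_pow this]
  have hexp : ∀ᶠ z in 𝓝[≠] (0 : ℂ), Complex.exp (p.eval z) - 1 = 0 := by
    filter_upwards [(tendsto_detk_one_sub_smul hk (hSA k hk 0)).eventually_ne one_ne_zero,
      (tendsto_detk_one_sub_smul hk (hSA k hk 1)).eventually_ne one_ne_zero] with z h0 h1
    have hzS : ∀ c, IsSchatten k (z • S c) := fun c =>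
      ((IsSchatten.unif (ι := Unit) (hSA k hk c)).smul z).isSchatten ()
    have h2 := (hQ _ _ (hzS 0) (hzS 1)).2.symm.trans (hR _ _ (hzS 0) (hzS 1)).2
    rw [hpeval, Complex.exp_sub, mul_left_cancel₀ (mul_ne_zero h0 h1) h2,
      div_self (Complex.exp_ne_zero _), sub_self]
  -- As exp p - 1 vanishes identically near 0, any order is available; |w| + 1 is the least that
  -- reaches degree |w|.
  have hcoeff := coeff_eq_zero_of_exp_eval_isBigO (k := w.length + 1) hp0
    ((IsBigO.of_bound 0 (by filter_upwards [hexp] with z hz; simp [hz]))) (Nat.lt_succ_self _)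
  rw [hp, Polynomial.finsetSum_coeff] at hcoeff
  simp only [Polynomial.coeff_C_mul_X_pow] at hcoeff
  rw [← hcoeff]
  have hterm : ∀ l ∈ d.support, (if w.length = l.length then
      d l * trace (eval (S 0) (S 1) (word l)) else 0) =
      ∑ i ∈ Finset.range w.length, if l = w.rotate i then d l else 0 := fun l hl => by
    split_ifs with hlen
    · have hSl : l.map ![S 0, S 1] = l.map S := by
        congr 1
        funext c
        fin_cases c <;> rfl
      rw [eval_word, hSl, hS, trace_list_prod_cyclicShift e hlen.symm, Finset.mul_sum]
      simp only [mul_ite, mul_one, mul_zero]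
    · symm
      refine Finset.sum_eq_zero fun i _ => if_neg fun h => hlen ?_
      rw [h, List.length_rotate]
  rw [Finset.sum_congr rfl hterm, Finset.sum_comm]
  refine Finset.sum_congr rfl fun i _ => ?_
  rw [Finset.sum_ite_eq']
  split_ifs with h
  · rfl
  · exact Finsupp.notMem_support_iff.1 h

end Uniqueness

/-! ### Computable word lists and the explicit polynomials for k ≤ 5. -/

section Terms

/-- A list of integer multiples of words. -/
abbrev Terms : Type := List (ℤ × List (Fin 2))

/-- The polynomial with the given terms. -/
noncomputable def Terms.toPoly (L : Terms) : NCPoly := (L.map fun t => (t.1 : ℂ) • word t.2).sum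

open Polynomial in
/-- The polynomial with the given terms, each word `w` being multiplied by `t ^ length w`. -/
noncomputable def Terms.graded (L : Terms) : Polynomial NCPoly :=
  (L.map fun t => (t.1 : ℂ) • (C (word t.2) * X ^ t.2.length)).sum

/-- The terms of a product. -/
def Terms.mul (L M : Terms) : Terms :=
  L.flatMap fun s => M.map fun t => (s.1 * t.1, s.2 ++ t.2)

/-- The terms of a power. -/
def Terms.pow (L : Terms) : ℕ → Terms
  | 0 => [(1, [])]
  | n + 1 => (L.pow n).mul L

/-- The terms of an integer multiple. -/
def Terms.scale (c : ℤ) (L : Terms) : Terms := L.map fun t => (c * t.1, t.2)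

theorem Terms.toPoly_append (L M : Terms) :
    Terms.toPoly (L ++ M) = Terms.toPoly L + Terms.toPoly M := by
  simp [toPoly]

theorem Terms.toPoly_cons (t : ℤ × List (Fin 2)) (L : Terms) :
    Terms.toPoly (t :: L) = (t.1 : ℂ) • word t.2 + Terms.toPoly L := by
  simp [toPoly]

theorem Terms.toPoly_scale (c : ℤ) (L : Terms) :
    Terms.toPoly (Terms.scale c L) = (c : ℂ) • Terms.toPoly L := by
  induction L with
  | nil => simp [toPoly, scale]
  | cons t L ih =>
    rw [toPoly_cons, smul_add, ← ih, smul_smul]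
    simp [toPoly, scale]

theorem Terms.graded_append (L M : Terms) :
    Terms.graded (L ++ M) = Terms.graded L + Terms.graded M := by
  simp [graded]

open Polynomial in
theorem Terms.graded_cons (t : ℤ × List (Fin 2)) (L : Terms) :
    Terms.graded (t :: L) = (t.1 : ℂ) • (C (word t.2) * X ^ t.2.length) + Terms.graded L := by
  simp [graded]

theorem Terms.graded_scale (c : ℤ) (L : Terms) :
    Terms.graded (Terms.scale c L) = (c : ℂ) • Terms.graded L := by
  induction L with
  | nil => simp [graded, scale]
  | cons t L ih =>
    rw [graded_cons, smul_add, ← ih, smul_smul]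
    simp [graded, scale]

open Polynomial in
theorem Terms.graded_mul (L M : Terms) :
    Terms.graded (Terms.mul L M) = Terms.graded L * Terms.graded M := by
  have h1 : ∀ (s : ℤ × List (Fin 2)) (M : Terms),
      Terms.graded (M.map fun t => (s.1 * t.1, s.2 ++ t.2)) =
        ((s.1 : ℂ) • (C (word s.2) * X ^ s.2.length)) * Terms.graded M := fun s M => by
    induction M with
    | nil => simp [graded]
    | cons t M ih =>
      rw [List.map_cons, graded_cons, graded_cons, ih, mul_add, smul_mul_smul_comm]
      congr 1
      have : (C (word s.2) * X ^ s.2.length) * (C (word t.2) * X ^ t.2.length) =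
          C (word (s.2 ++ t.2)) * X ^ (s.2 ++ t.2).length := by
        rw [word_append, C_mul, List.length_append, pow_add, mul_assoc, mul_assoc,
          ← mul_assoc (X ^ _), X_pow_mul_C, mul_assoc]
      rw [this]
      push_cast
      rfl
  induction L with
  | nil => simp [graded, mul]
  | cons s L ih =>
    rw [graded_cons, add_mul, ← ih, ← h1, ← graded_append]
    rfl

theorem Terms.graded_pow (L : Terms) (n : ℕ) :
    Terms.graded (Terms.pow L n) = Terms.graded L ^ n := by
  induction n with
  | zero => simp [graded, pow, word]
  | succ n ih => rw [pow, graded_mul, ih, pow_succ]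

theorem Terms.sum_coeff_graded (a b : ℕ) (L : Terms) :
    ∑ m ∈ Finset.Icc a b, (Terms.graded L).coeff m =
      Terms.toPoly (L.filter fun t => a ≤ t.2.length ∧ t.2.length ≤ b) := by
  induction L with
  | nil => simp [graded, toPoly]
  | cons t L ih =>
    rw [graded_cons]
    simp only [Polynomial.coeff_add, Finset.sum_add_distrib, ih, Polynomial.coeff_smul,
      Polynomial.coeff_C_mul_X_pow, smul_ite, smul_zero, Finset.sum_ite_eq', Finset.mem_Icc]
    rw [List.filter_cons]
    split_ifs with h1 h2 h2
    · rw [toPoly_cons]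
    · simp [h1] at h2
    · simp [h1] at h2
    · rw [zero_add]

/-- The terms of `12 * generating k`, for `k ≤ 5`. -/
def generatingTerms (k : ℕ) : Terms :=
  (List.range (k - 1)).flatMap fun (j : ℕ) => Terms.scale (12 / ((j : ℤ) + 1))
    (Terms.pow [(1, [0]), (1, [1]), (-1, [0, 1])] (j + 1) ++
      Terms.scale (-1) (Terms.pow [(1, [0])] (j + 1)) ++
      Terms.scale (-1) (Terms.pow [(1, [1])] (j + 1)))

open Polynomial in
theorem graded_generatingTerms {k : ℕ} (hk : k ≤ 5) :
    Terms.graded (generatingTerms k) = (12 : ℂ) • generating k := by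
  have hA : Terms.graded [(1, [0])] = C varA * X := by simp [Terms.graded, word]
  have hB : Terms.graded [(1, [1])] = C varB * X := by simp [Terms.graded, word]
  have hX : Terms.graded [(1, [0]), (1, [1]), (-1, [0, 1])] =
      C varA * X + C varB * X - C (varA * varB) * X ^ 2 := by
    simp [Terms.graded, word]
    abel
  have hflat : ∀ (n : ℕ) (f : ℕ → Terms),
      Terms.graded ((List.range n).flatMap f) = ∑ j ∈ Finset.range n, Terms.graded (f j) := by
    intro n f
    induction n with
    | zero => simp [Terms.graded]
    | succ n ih =>
      rw [List.range_succ, List.flatMap_append, Terms.graded_append, ih, Finset.sum_range_succ]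
      simp
  have hIcc : Finset.Icc 1 (k - 1) = Finset.Ico (0 + 1) (k - 1 + 1) := by
    ext j
    simp only [Finset.mem_Icc, Finset.mem_Ico]
    omega
  rw [generatingTerms, hflat, generating, Finset.smul_sum, hIcc, Finset.range_eq_Ico,
    ← Finset.sum_Ico_add']
  refine Finset.sum_congr rfl fun j hj => ?_
  have hj5 : j < 4 := by
    have := (Finset.mem_Ico.1 hj).2
    omega
  -- The integer division is exact: j + 1 is one of 1, 2, 3, 4, and 12 is their least common
  -- multiple.
  have hc : ((12 / ((j : ℤ) + 1) : ℤ) : ℂ) = 12 * (1 / ((j + 1 : ℕ) : ℂ)) := by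
    interval_cases j <;> norm_num
  rw [Terms.graded_scale, Terms.graded_append, Terms.graded_append, Terms.graded_scale,
    Terms.graded_scale, Terms.graded_pow, Terms.graded_pow, Terms.graded_pow, hA, hB, hX, hc,
    mul_smul]
  congr 2
  push_cast
  module

/-- A cyclic rotation of `w` with the smallest binary value. -/
def leastRotation (w : List (Fin 2)) : List (Fin 2) :=
  let code := fun i => (w.rotate i).foldl (fun n c => 2 * n + c.val) 0
  w.rotate ((List.range w.length).foldl (fun b i => if code i < code b then i else b) 0)

/-- Add a term to a list of terms, collecting equal words. -/
def Terms.insertTerm (t : ℤ × List (Fin 2)) : Terms → Terms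
  | [] => [t]
  | t' :: L => if t.2 = t'.2 then (t.1 + t'.1, t.2) :: L else t' :: Terms.insertTerm t L

/-- Collect the terms up to cyclic rotation. -/
def Terms.collect (L : Terms) : Terms :=
  L.foldr (fun t M => Terms.insertTerm (t.1, leastRotation t.2) M) []

theorem Terms.toPoly_insertTerm (t : ℤ × List (Fin 2)) (L : Terms) :
    Terms.toPoly (Terms.insertTerm t L) = (t.1 : ℂ) • word t.2 + Terms.toPoly L := by
  induction L with
  | nil => simp [insertTerm, toPoly]
  | cons t' L ih =>
    rw [insertTerm]
    split_ifs with h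
    · rw [toPoly_cons, toPoly_cons, ← add_assoc, ← h, ← add_smul]
      push_cast
      rfl
    · rw [toPoly_cons, toPoly_cons, ih]
      abel

/-- Soundness only needs `leastRotation` to be some rotation; its minimality merely makes
cancellations visible to the computation. -/
theorem Terms.mkQ_toPoly_collect (L : Terms) :
    cyclicSpan.mkQ (Terms.toPoly (Terms.collect L)) = cyclicSpan.mkQ (Terms.toPoly L) := by
  induction L with
  | nil => rfl
  | cons t L ih =>
    rw [collect, List.foldr_cons, ← collect, toPoly_insertTerm, toPoly_cons, map_add, map_add, ih,
      map_smul, map_smul, leastRotation, mkQ_word_rotate]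

theorem Terms.toPoly_mem_cyclicSpan {L : Terms} (h : ∀ t ∈ Terms.collect L, t.1 = 0) :
    Terms.toPoly L ∈ cyclicSpan := by
  rw [← Submodule.Quotient.mk_eq_zero, ← Submodule.mkQ_apply, ← mkQ_toPoly_collect]
  have h0 : Terms.toPoly (Terms.collect L) = 0 := by
    refine List.sum_eq_zero fun x hx => ?_
    obtain ⟨t, ht, rfl⟩ := List.mem_map.1 hx
    rw [h t ht, Int.cast_zero, zero_smul]
  rw [h0, map_zero]

/-- The terms of `12 * explicitT k`. -/
def explicitTerms : ℕ → Terms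
  | 2 => [(-12, [0, 1])]
  | 3 => [(-12, [0, 0, 1]), (-12, [0, 1, 1]), (6, [0, 1, 0, 1])]
  | 4 => [(-12, [0, 0, 0, 1]), (-12, [0, 1, 1, 1]), (-6, [0, 1, 0, 1]), (-12, [0, 0, 1, 1]),
      (12, [0, 0, 1, 0, 1]), (12, [0, 1, 1, 0, 1]), (-4, [0, 1, 0, 1, 0, 1])]
  | 5 => [(-12, [0, 0, 0, 0, 1]), (-12, [0, 1, 1, 1, 1]), (-12, [0, 0, 0, 1, 1]),
      (-12, [0, 0, 1, 1, 1]), (-12, [0, 0, 1, 0, 1]), (-12, [0, 1, 1, 0, 1]),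
      (12, [0, 0, 0, 1, 0, 1]), (12, [0, 1, 1, 1, 0, 1]), (12, [0, 0, 1, 1, 0, 1]),
      (12, [0, 0, 1, 0, 1, 1]), (8, [0, 1, 0, 1, 0, 1]), (6, [0, 0, 1, 0, 0, 1]),
      (6, [0, 1, 1, 0, 1, 1]), (-12, [0, 0, 1, 0, 1, 0, 1]), (-12, [0, 1, 1, 0, 1, 0, 1]),
      (3, [0, 1, 0, 1, 0, 1, 0, 1])]
  | _ => []

theorem toPoly_explicitTerms {k : ℕ} (hk : k ∈ Finset.Icc 1 5) :
    Terms.toPoly (explicitTerms k) = (12 : ℂ) • explicitT k := by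
  obtain ⟨h1, h5⟩ := Finset.mem_Icc.1 hk
  interval_cases k <;>
    simp only [explicitTerms, explicitT, Terms.toPoly, word, List.map_cons, List.map_nil,
      List.sum_cons, List.sum_nil, List.prod_cons, List.prod_nil, mul_one, pow_succ, pow_zero,
      one_mul, mul_assoc] <;> push_cast <;> module

theorem hasTermsOfDegreeGE_explicitT {k : ℕ} (hk : k ∈ Finset.Icc 1 5) :
    HasTermsOfDegreeGE k (explicitT k) := by
  have hlen : ∀ t ∈ explicitTerms k, k ≤ t.2.length := by
    obtain ⟨h1, h5⟩ := Finset.mem_Icc.1 hk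
    interval_cases k <;> decide
  have h : Terms.toPoly (explicitTerms k) ∈
      Submodule.span ℂ {q : NCPoly | ∃ l : List (Fin 2), k ≤ l.length ∧ q = word l} := by
    refine list_sum_mem fun x hx => ?_
    obtain ⟨t, ht, rfl⟩ := List.mem_map.1 hx
    exact Submodule.smul_mem _ _ (Submodule.subset_span ⟨t.2, hlen t ht, rfl⟩)
  rw [toPoly_explicitTerms hk] at h
  have h2 := Submodule.smul_mem _ (1 / 12 : ℂ) h
  rw [smul_smul] at h2
  norm_num at h2
  exact h2

theorem collect_explicitTerms_eq_zero {k : ℕ} (hk : k ∈ Finset.Icc 1 5) :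
    ∀ t ∈ Terms.collect (explicitTerms k ++ Terms.scale (-1) ((generatingTerms k).filter fun t =>
      k ≤ t.2.length ∧ t.2.length ≤ 2 * k - 2)), t.1 = 0 := by
  obtain ⟨h1, h5⟩ := Finset.mem_Icc.1 hk
  -- For each k a finite computation with integers: after collection up to rotation all coefficients
  -- cancel.
  interval_cases k <;> decide +kernel

theorem cyclicEquiv_explicitT {k : ℕ} (hk : k ∈ Finset.Icc 1 5) :
    CyclicEquiv (explicitT k) (T k) := by
  have h := Terms.toPoly_mem_cyclicSpan (collect_explicitTerms_eq_zero hk)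
  have hT : Terms.toPoly ((generatingTerms k).filter fun t =>
      k ≤ t.2.length ∧ t.2.length ≤ 2 * k - 2) = (12 : ℂ) • T k := by
    rw [← Terms.sum_coeff_graded, graded_generatingTerms (Finset.mem_Icc.1 hk).2]
    simp only [Polynomial.coeff_smul]
    rw [← Finset.smul_sum]
    rfl
  rw [Terms.toPoly_append, Terms.toPoly_scale, hT, toPoly_explicitTerms hk] at h
  have h2 := Submodule.smul_mem _ (1 / 12 : ℂ) h
  have h3 : (1 / 12 : ℂ) • ((12 : ℂ) • explicitT k + ((-1 : ℤ) : ℂ) • (12 : ℂ) • T k) =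
      explicitT k - T k := by
    push_cast
    module
  rw [h3] at h2
  exact h2

end Terms

end SchattenDet

theorem lemma4p1 (H : Type*) [NormedAddCommGroup H] [InnerProductSpace ℂ H] [CompleteSpace H]
    [TopologicalSpace.SeparableSpace H] :
    (∀ k : ℕ, 1 ≤ k →
      -- all determinants and traces that occur below are well defined
      (∀ A B : H →L[ℂ] H, IsSchatten k A → IsSchatten k B →
        IsSchatten k (1 - (1 - A) * (1 - B))) ∧
      (∀ A : H →L[ℂ] H, IsSchatten k A →
        IsTraceClass (regularize k (1 - A) - 1) ∧
        Tendsto (compressionDet (regularize k (1 - A))) atTop (𝓝 (detk k (1 - A)))) ∧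
      (∀ S : H →L[ℂ] H, IsTraceClass S → Summable fun i => entry S i i) ∧
      -- the expansion in powers of t
      generating k =
        ∑ m ∈ Finset.Icc 1 (2 * k - 2), Polynomial.C (P k m) * Polynomial.X ^ m ∧
      (∀ m ∈ Finset.Icc 1 (2 * k - 2), IsHomogeneousOfDegree m (P k m)) ∧
      -- the determinant formula
      IsDetCorrection H k (T k) ∧
      -- uniqueness up to cyclic permutations of the terms
      (¬ FiniteDimensional ℂ H → ∀ Q : NCPoly, IsDetCorrection H k Q → CyclicEquiv Q (T k)) ∧
      -- terms may be permuted cyclically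
      (∀ Q : NCPoly, HasTermsOfDegreeGE k Q → CyclicEquiv Q (T k) → IsDetCorrection H k Q)) ∧
    -- explicit forms for k = 1, ..., 5
    (∀ k ∈ Finset.Icc 1 5,
      CyclicEquiv (explicitT k) (T k) ∧ IsDetCorrection H k (explicitT k)) := by

  refine ⟨fun k hk => ⟨fun A B hA hB => ?_, fun A hA => ⟨?_, ?_⟩, fun S hS => hS.summable_entry,
    generating_eq_sum k, fun m _ => coeffHomogeneous_generating k m,
    isDetCorrection_of_cyclicEquiv hk (hasTermsOfDegreeGE_T k) (CyclicEquiv.refl _),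
    fun hH Q hQ => cyclicEquiv_of_isDetCorrection hH hk hQ
      (isDetCorrection_of_cyclicEquiv hk (hasTermsOfDegreeGE_T k) (CyclicEquiv.refl _)),
    fun Q hQ hQT => isDetCorrection_of_cyclicEquiv hk hQ hQT⟩,
    fun k hk => ⟨cyclicEquiv_explicitT hk, isDetCorrection_of_cyclicEquiv (Finset.mem_Icc.1 hk).1
      (hasTermsOfDegreeGE_explicitT hk) (cyclicEquiv_explicitT hk)⟩⟩
  · rw [show 1 - (1 - A) * (1 - B) = A + B - A * B by noncomm_ring]
    exact ((IsSchatten.unif (ι := Unit) hA).add_sub_mul (IsSchatten.unif hB) (norm_nonneg B)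
      fun _ => le_rfl).isSchatten ()
  · exact ((IsSchatten.unif (ι := Unit) hA).regularize hk).isSchatten ()
  -- The constant family gives convergence of the compressions of the regularized operator itself.
  · exact tendsto_detk hk (IsSchatten.unif hA) hA tendsto_const_nhds
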